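/- For a real positive semidefinite $n\times n$ matrix $A$ with eigenvalues $\lambda_1\ge\dots\ge\lambda_n$ and $1\le k\le n$, let $\mathbb{S}_k$ be the set of $x\in\mathbb{R}^n$ with $\|x\|_2=1$ and exactly $k$ nonzero entries. For $\epsilon>0$, a $(1-\epsilon)$-approximate $k$-sparse principal component of $A$ is a vector $x\in\mathbb{S}_k$ with $x^TAx\ge(1-\epsilon)\,y^TAy$ for all $y\in\mathbb{S}_k$. Running time is counted on a random access machine with exact real arithmetic (arithmetic operations, square roots, comparisons and memory accesses cost one step each), on which an exact computation of the $r$ leading eigenvalues and orthonormal eigenvectors of a symmetric $m\times m$ matrix costs $rm^2$ steps. There is one algorithm, with input $k$, $d$, $A$, such that the following holds for all $\alpha>0$, $0<\delta\le 1$ and $\epsilon>0$. Let $d$ be the least nonnegative integer with $d+1\ge (1/(\epsilon\delta))^{1/\alpha}$. Then there is a function $T:\mathbb{N}\to\mathbb{N}$, depending only on $\alpha,\delta,\epsilon$, with $$T(n)=O\!\left(n^{(1/(\epsilon\delta))^{1/\alpha}+1}\log n\right)\quad\text{and}\quad T(n)=O\!\left(n^{(1/(\epsilon\delta))^{\alpha}+1}\log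 n\right)\qquad(n\to\infty),$$ such that for every $n\ge d+1$, every $k=\delta n$ (an integer) and every positive semidefinite $A\in\mathbb{R}^{n\times n}$ whose first $d+1$ eigenvalues follow a power law, $\lambda_i=C\,i^{-\alpha}$ for $1\le i\le d+1$ and some $C>0$, the algorithm outputs a $(1-\epsilon)$-approximate $k$-sparse principal component of $A$ after at most $T(n)$ steps. In particular, for fixed $\alpha,\delta,\epsilon$ the running time is bounded by a polynomial in $n$, i.e. the algorithm is a polynomial-time approximation scheme. -/

import Mathlib

open Matrix Filter Asymptotics

noncomputable section

namespace SparsePCA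

/-! ### Sparse principal components -/

/-- The `i`-th largest eigenvalue (counted from `i = 0`, with multiplicity) of a real symmetric
`n × n` matrix. -/
def eigval {n : ℕ} {M : Matrix (Fin n) (Fin n) ℝ} (hM : M.IsHermitian) (i : Fin n) : ℝ :=
  hM.eigenvalues₀ (Fin.cast (Fintype.card_fin n).symm i)

/-- `x` belongs to `𝕊_k`: it has Euclidean norm one and exactly `k` nonzero entries. -/
def IsSparseUnit {n : ℕ} (k : ℕ) (x : Fin n → ℝ) : Prop :=
  ∑ i, x i ^ 2 = 1 ∧ (Finset.univ.filter fun i => x i ≠ 0).card = k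

/-- `x` is a `(1 - ε)`-approximate `k`-sparse principal component of `M`: a `k`-sparse unit vector
whose quadratic form is at least `1 - ε` times the supremum over all `k`-sparse unit vectors. -/
def IsApproxSparsePC {n : ℕ} (M : Matrix (Fin n) (Fin n) ℝ) (k : ℕ) (ε : ℝ)
    (x : Fin n → ℝ) : Prop :=
  IsSparseUnit k x ∧ ∀ y : Fin n → ℝ, IsSparseUnit k y →
    (1 - ε) * (y ⬝ᵥ (M *ᵥ y)) ≤ x ⬝ᵥ (M *ᵥ x)

/-! ### Eigensolvers -/

/-- An exact solver for the symmetric eigenvalue problem. On a symmetric `m × m` matrix `M`,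
`val m M i` is the `i`-th largest eigenvalue and `vec m M i` (entries `vec m M i l`, `l < m`) is a
corresponding eigenvector; the eigenvectors are orthonormal. Nothing is required on other inputs,
and which eigenvectors are returned is left to the solver. -/
structure Eigensolver where
  val : (m : ℕ) → Matrix (Fin m) (Fin m) ℝ → ℕ → ℝ
  vec : (m : ℕ) → Matrix (Fin m) (Fin m) ℝ → ℕ → ℕ → ℝ
  val_eq : ∀ (m : ℕ) (M : Matrix (Fin m) (Fin m) ℝ) (hM : M.IsHermitian) (i : Fin m),
    val m M i = eigval hM i
  orthonormal : ∀ (m : ℕ) (M : Matrix (Fin m) (Fin m) ℝ), M.IsHermitian → ∀ i j : Fin m,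
    ∑ l : Fin m, vec m M i l * vec m M j l = if i = j then 1 else 0
  eigen : ∀ (m : ℕ) (M : Matrix (Fin m) (Fin m) ℝ), M.IsHermitian → ∀ i p : Fin m,
    ∑ l : Fin m, M p l * vec m M i l = val m M i * vec m M i p

/-- Eigensolvers exist, by the spectral theorem. -/
theorem Eigensolver.nonempty : Nonempty Eigensolver := by
  classical
  let e : (m : ℕ) → Fin m → Fin m := fun m i =>
    Fintype.equivOfCardEq (Fintype.card_fin (Fintype.card (Fin m)))
      (Fin.cast (Fintype.card_fin m).symm i)
  have he : ∀ m, Function.Injective (e m) := fun m a b h =>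
    Fin.cast_injective _ (Equiv.injective _ h)
  refine ⟨⟨fun m M i => if h : M.IsHermitian ∧ i < m then eigval h.1 ⟨i, h.2⟩ else 0,
    fun m M i l => if h : M.IsHermitian ∧ i < m ∧ l < m then
      h.1.eigenvectorBasis (e m ⟨i, h.2.1⟩) ⟨l, h.2.2⟩ else 0, ?_, ?_, ?_⟩⟩
  · intro m M hM i
    exact dif_pos ⟨hM, i.2⟩
  · intro m M hM i j
    have h := orthonormal_iff_ite.mp hM.eigenvectorBasis.orthonormal (e m i) (e m j)
    simp only [(he m).eq_iff] at h
    rw [← h, PiLp.inner_apply]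
    refine Finset.sum_congr rfl fun l _ => ?_
    rw [dif_pos ⟨hM, i.2, l.2⟩, dif_pos ⟨hM, j.2, l.2⟩]
    exact mul_comm _ _
  · intro m M hM i p
    have h := congrFun (hM.mulVec_eigenvectorBasis (e m i)) p
    have h2 : hM.eigenvalues (e m i) = eigval hM i := by
      simp [Matrix.IsHermitian.eigenvalues, eigval, e]
    rw [h2] at h
    rw [dif_pos ⟨hM, i.2⟩, dif_pos ⟨hM, i.2, p.2⟩]
    refine Eq.trans (Finset.sum_congr rfl fun l _ => ?_) h
    rw [dif_pos ⟨hM, i.2, l.2⟩]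

/-! ### Programs for a real random access machine -/

/-- The memory of the machine: cells for natural numbers (indices and counters) and cells for real
numbers, both addressed by natural numbers. -/
structure State where
  nat : ℕ → ℕ
  real : ℕ → ℝ

/-- Natural number expressions: constants, contents of the memory cell with a given address,
sums and truncated differences. -/
inductive NExp
  | const (c : ℕ)
  | cell (a : NExp)
  | add (a b : NExp)
  | sub (a b : NExp)

/-- Real expressions: rational constants, contents of the memory cell with a given address,
the value of a natural number expression, the arithmetic operations and the square root.
There is no rounding from the reals to the natural numbers. -/
inductive RExp
  | const (q : ℚ)
  | cell (a : NExp)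
  | ofNat (a : NExp)
  | add (a b : RExp)
  | sub (a b : RExp)
  | mul (a b : RExp)
  | div (a b : RExp)
  | sqrt (a : RExp)

/-- Tests: comparison of two natural numbers or of two reals. -/
inductive Cond
  | natLt (a b : NExp)
  | realLt (a b : RExp)

/-- Programs. `setN a e` and `setR a e` store the value of `e` in the cell with address `a`.
`eig src m r dst` reads the `m × m` matrix stored from address `src` on and writes its `r` leading
eigenpairs (all of them if `m < r`) from address `dst` on: see `eigWrite`. -/
inductive Cmd
  | setN (a e : NExp)
  | setR (a : NExp) (e : RExp)
  | seq (P Q : Cmd)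
  | ite (c : Cond) (P Q : Cmd)
  | loop (c : Cond) (P : Cmd)
  | eig (src m r dst : NExp)

/-- Value of a natural number expression. -/
def NExp.eval (s : State) : NExp → ℕ
  | .const c => c
  | .cell a => s.nat (a.eval s)
  | .add a b => a.eval s + b.eval s
  | .sub a b => a.eval s - b.eval s

/-- Value of a real expression. -/
def RExp.eval (s : State) : RExp → ℝ
  | .const q => (q : ℝ)
  | .cell a => s.real (a.eval s)
  | .ofNat a => (a.eval s : ℝ)
  | .add a b => a.eval s + b.eval s
  | .sub a b => a.eval s - b.eval s
  | .mul a b => a.eval s * b.eval s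
  | .div a b => a.eval s / b.eval s
  | .sqrt a => Real.sqrt (a.eval s)

/-- Truth of a test. -/
def Cond.Holds (s : State) : Cond → Prop
  | .natLt a b => a.eval s < b.eval s
  | .realLt a b => a.eval s < b.eval s

/-- Number of elementary operations in the evaluation of a natural number expression. -/
def NExp.cost : NExp → ℕ
  | .const _ => 1
  | .cell a => a.cost + 1
  | .add a b => a.cost + b.cost + 1
  | .sub a b => a.cost + b.cost + 1

/-- Number of elementary operations in the evaluation of a real expression. -/
def RExp.cost : RExp → ℕ
  | .const _ => 1
  | .cell a => a.cost + 1
  | .ofNat a => a.cost + 1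
  | .add a b => a.cost + b.cost + 1
  | .sub a b => a.cost + b.cost + 1
  | .mul a b => a.cost + b.cost + 1
  | .div a b => a.cost + b.cost + 1
  | .sqrt a => a.cost + 1

/-- Number of elementary operations in a test. -/
def Cond.cost : Cond → ℕ
  | .natLt a b => a.cost + b.cost + 1
  | .realLt a b => a.cost + b.cost + 1

/-- The `m × m` matrix stored row by row in the real cells from address `src` on. -/
def readMatrix (mem : ℕ → ℝ) (src m : ℕ) : Matrix (Fin m) (Fin m) ℝ :=
  Matrix.of fun i j => mem (src + i * m + j)

/-- The real memory after the `r` leading eigenpairs of the `m × m` matrix `M` have been written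
from address `dst` on: first the `r` eigenvalues, then the `r` eigenvectors one after the other. -/
def eigWrite (O : Eigensolver) (mem : ℕ → ℝ) (m : ℕ) (M : Matrix (Fin m) (Fin m) ℝ)
    (r dst : ℕ) : ℕ → ℝ := fun a =>
  if a < dst then mem a
  else if a < dst + r then O.val m M (a - dst)
  else if a < dst + r + r * m then O.vec m M ((a - dst - r) / m) ((a - dst - r) % m)
  else mem a

/-- `Cmd.Runs O P s t s'`: started in state `s`, the program `P` halts in state `s'` after exactly
`t` time steps. Every elementary operation takes one step; the computation of the `r` leading
eigenpairs of an `m × m` matrix takes `r * m ^ 2` steps. -/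
inductive Cmd.Runs (O : Eigensolver) : Cmd → State → ℕ → State → Prop
  | setN (a e : NExp) (s : State) :
      Cmd.Runs O (.setN a e) s (a.cost + e.cost + 1)
        ⟨Function.update s.nat (a.eval s) (e.eval s), s.real⟩
  | setR (a : NExp) (e : RExp) (s : State) :
      Cmd.Runs O (.setR a e) s (a.cost + e.cost + 1)
        ⟨s.nat, Function.update s.real (a.eval s) (e.eval s)⟩
  | seq {P Q : Cmd} {s s' s'' : State} {t t' : ℕ} :
      Cmd.Runs O P s t s' → Cmd.Runs O Q s' t' s'' → Cmd.Runs O (.seq P Q) s (t + t') s''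
  | ite_true {c : Cond} {P Q : Cmd} {s s' : State} {t : ℕ} :
      c.Holds s → Cmd.Runs O P s t s' → Cmd.Runs O (.ite c P Q) s (c.cost + t) s'
  | ite_false {c : Cond} {P Q : Cmd} {s s' : State} {t : ℕ} :
      ¬ c.Holds s → Cmd.Runs O Q s t s' → Cmd.Runs O (.ite c P Q) s (c.cost + t) s'
  | loop_true {c : Cond} {P : Cmd} {s s' s'' : State} {t t' : ℕ} :
      c.Holds s → Cmd.Runs O P s t s' → Cmd.Runs O (.loop c P) s' t' s'' →
        Cmd.Runs O (.loop c P) s (c.cost + t + t') s''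
  | loop_false {c : Cond} {P : Cmd} {s : State} :
      ¬ c.Holds s → Cmd.Runs O (.loop c P) s c.cost s
  | eig (src m r dst : NExp) (s : State) :
      Cmd.Runs O (.eig src m r dst) s
        (src.cost + m.cost + r.cost + dst.cost + min (r.eval s) (m.eval s) * m.eval s ^ 2 + 1)
        ⟨s.nat, eigWrite O s.real (m.eval s) (readMatrix s.real (src.eval s) (m.eval s))
          (min (r.eval s) (m.eval s)) (dst.eval s)⟩

/-- The machine is deterministic: time and result of a run are determined by the initial state. -/
theorem Cmd.Runs.unique {O : Eigensolver} {P : Cmd} {s : State} {t : ℕ} {s' : State}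
    (h : Cmd.Runs O P s t s') :
    ∀ {t₂ : ℕ} {s₂ : State}, Cmd.Runs O P s t₂ s₂ → t₂ = t ∧ s₂ = s' := by
  induction h with
  | setN a e s => intro t₂ s₂ h; cases h; exact ⟨rfl, rfl⟩
  | setR a e s => intro t₂ s₂ h; cases h; exact ⟨rfl, rfl⟩
  | seq _ _ ih₁ ih₂ =>
    intro t₂ s₂ h
    cases h with
    | seq h₁ h₂ =>
      obtain ⟨rfl, rfl⟩ := ih₁ h₁
      obtain ⟨rfl, rfl⟩ := ih₂ h₂
      exact ⟨rfl, rfl⟩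
  | ite_true hc _ ih =>
    intro t₂ s₂ h
    cases h with
    | ite_true _ h₁ => obtain ⟨rfl, rfl⟩ := ih h₁; exact ⟨rfl, rfl⟩
    | ite_false hn _ => exact absurd hc hn
  | ite_false hn _ ih =>
    intro t₂ s₂ h
    cases h with
    | ite_true hc _ => exact absurd hc hn
    | ite_false _ h₁ => obtain ⟨rfl, rfl⟩ := ih h₁; exact ⟨rfl, rfl⟩
  | loop_true hc _ _ ih₁ ih₂ =>
    intro t₂ s₂ h
    cases h with
    | loop_true _ h₁ h₂ =>
      obtain ⟨rfl, rfl⟩ := ih₁ h₁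
      obtain ⟨rfl, rfl⟩ := ih₂ h₂
      exact ⟨rfl, rfl⟩
    | loop_false hn => exact absurd hc hn
  | loop_false hn =>
    intro t₂ s₂ h
    cases h with
    | loop_true hc _ _ => exact absurd hc hn
    | loop_false _ => exact ⟨rfl, rfl⟩
  | eig src m r dst s => intro t₂ s₂ h; cases h; exact ⟨rfl, rfl⟩

/-- The initial memory on input `(k, d, M)` with `M` an `n × n` matrix: the natural number cells
`0`, `1`, `2` contain `n`, `k`, `d`; the real cells with addresses below `n ^ 2` contain the entries
of `M` row by row; all other cells contain zero. -/
def initState {n : ℕ} (k d : ℕ) (M : Matrix (Fin n) (Fin n) ℝ) : State where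
  nat := fun a => if a = 0 then n else if a = 1 then k else if a = 2 then d else 0
  real := fun a => if h : a < n * n then
    M ⟨a / n, Nat.div_lt_of_lt_mul h⟩
      ⟨a % n, Nat.mod_lt a (Nat.pos_of_mul_pos_left (Nat.zero_lt_of_lt h))⟩ else 0

/-- The output of a halted run: the vector of the first `n` real cells. -/
def output (n : ℕ) (s : State) : Fin n → ℝ := fun i => s.real i

/-- On input `(k, d, M)`, and with the eigensolver `O`, the program `P` halts after at most `T`
steps and outputs a `(1 - ε)`-approximate `k`-sparse principal component of `M`. -/
def Solves (O : Eigensolver) (P : Cmd) {n : ℕ} (k d : ℕ) (M : Matrix (Fin n) (Fin n) ℝ)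
    (ε : ℝ) (T : ℕ) : Prop :=
  ∃ (t : ℕ) (s : State), P.Runs O (initState k d M) t s ∧ t ≤ T ∧
    IsApproxSparsePC M k ε (output n s)

end SparsePCA

end

/-! Write `λ_1 ≥ λ_2 ≥ …` for the eigenvalues, `v_j` for the eigenvectors, `B` for the quadratic
form of the first `d` spectral terms, and `ρ = λ_{d+1} / λ_1`. By the power law `ρ = (d + 1)^(-α)`,
and the choice of `d` says precisely that `ρ ≤ ε δ`.

Search in dimension `d`. Let `h(y) ∈ ℝ^d` have the coordinates `√λ_j ⟨v_j, y⟩`, so that `B(y) =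
|h(y)|²`. For `g ∈ ℝ^d` the vector `w_g = ∑ g_j √λ_j v_j` satisfies `⟨w_g, y⟩ = ⟨g, h(y)⟩`.
Cauchy–Schwarz in `ℝ^d` and in `ℝ^n` shows that maximizing `B` over sparse unit vectors amounts to
maximizing the score of `g`, the sum of the `k` largest squared entries of `w_g` divided by `|g|²`.
Only the direction of `g` matters, and the grid `{-N, …, N}^d` with `N ≥ 2d / ρ` loses at most the
factor `1 - d / N² ≥ 1 - ρ / 2` (`exists_lowRank_le_score`). Truncating `w_g` realizes its score,
except that exactly `k` nonzero entries are required: zeros among the `k` largest are replaced by a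
small filler, at the cost of another factor `1 - ρ / 2` (`score_le_lowRank_truncation`). Hence the
output `x` satisfies `B(x) ≥ (1 - ρ) B(y)` for every competitor `y`.

Tail. A unit vector satisfies `yᵀAy ≤ (1 - ρ) B(y) + ρ λ_1` (`Eigensolver.val_mul_quadForm_le`); the
factor `1 - ρ` here pays for the loss in the search, so `yᵀAy ≤ B(x) + ρ λ_1`. The truncation of
`v_1` keeps at least the fraction `k / n = δ` of its mass (`exists_mul_le_score`), so `(1 - ρ / 2) δ
λ_1 ≤ B(x)`, and the additive error `ρ λ_1 ≤ ε δ λ_1` becomes a relative error `ε`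
(`isApproxSparsePC_of_bestSoFar`).

Time. The grid depends on `d` and `ρ` only, so for `d ≥ 1` the time is `O(n²)`, from the eigensolver
and from ranking entries by comparing all pairs. Since `d ≥ 1` forces `1 / (ε δ) > 1`, both
exponents claimed exceed `2`. For `d = 0` one has `ε ≥ 1`, and any sparse unit vector will do. -/

noncomputable section

namespace SparsePCA

/-! ### Time-bounded total correctness -/

/-- Started in `s`, the program `P` halts after at most `T` steps in a state satisfying `Q`. -/
def Ends (O : Eigensolver) (P : Cmd) (s : State) (T : ℕ) (Q : State → Prop) : Prop :=
  ∃ t s', P.Runs O s t s' ∧ t ≤ T ∧ Q s'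

theorem Ends.mono {O : Eigensolver} {P : Cmd} {s : State} {T T' : ℕ} {Q Q' : State → Prop}
    (h : Ends O P s T Q) (hT : T ≤ T') (hQ : ∀ s', Q s' → Q' s') : Ends O P s T' Q' := by
  obtain ⟨t, s', hr, ht, hq⟩ := h
  exact ⟨t, s', hr, ht.trans hT, hQ s' hq⟩

theorem Ends.seq {O : Eigensolver} {P P' : Cmd} {s : State} {T T' : ℕ} {Q Q' : State → Prop}
    (h : Ends O P s T Q) (h' : ∀ s', Q s' → Ends O P' s' T' Q') :
    Ends O (.seq P P') s (T + T') Q' := by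
  obtain ⟨t, s', hr, ht, hq⟩ := h
  obtain ⟨t', s'', hr', ht', hq'⟩ := h' s' hq
  exact ⟨t + t', s'', .seq hr hr', Nat.add_le_add ht ht', hq'⟩

theorem Ends.ite {O : Eigensolver} {c : Cond} {P P' : Cmd} {s : State} {T : ℕ}
    {Q : State → Prop} (h : c.Holds s → Ends O P s T Q) (h' : ¬ c.Holds s → Ends O P' s T Q) :
    Ends O (.ite c P P') s (c.cost + T) Q := by
  by_cases hc : c.Holds s
  · obtain ⟨t, s', hr, ht, hq⟩ := h hc
    exact ⟨_, s', .ite_true hc hr, Nat.add_le_add_left ht _, hq⟩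
  · obtain ⟨t, s', hr, ht, hq⟩ := h' hc
    exact ⟨_, s', .ite_false hc hr, Nat.add_le_add_left ht _, hq⟩

/-- A loop whose invariant counts the `m` executions of its body. -/
theorem Ends.loop {O : Eigensolver} {c : Cond} {P : Cmd} {T m : ℕ} {I : ℕ → State → Prop}
    (hstep : ∀ i < m, ∀ s, I i s → c.Holds s ∧ Ends O P s T (I (i + 1)))
    (hend : ∀ s, I m s → ¬ c.Holds s) {s : State} (h : I 0 s) :
    Ends O (.loop c P) s (m * (T + c.cost) + c.cost) (I m) := by
  suffices H : ∀ r i, i + r = m → ∀ s, I i s →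
      Ends O (.loop c P) s (r * (T + c.cost) + c.cost) (I m) from H m 0 (by omega) s h
  intro r
  induction r with
  | zero =>
    intro i hi s hs
    obtain rfl : i = m := by omega
    exact ⟨_, s, .loop_false (hend s hs), by omega, hs⟩
  | succ r ih =>
    intro i hi s hs
    obtain ⟨hc, t, s', hr, ht, hq⟩ := hstep i (by omega) s hs
    obtain ⟨t', s'', hr', ht', hq'⟩ := ih (i + 1) (by omega) s' hq
    refine ⟨_, s'', .loop_true hc hr hr', ?_, hq'⟩
    rw [Nat.succ_mul]
    omega

/-- Programs without loops and eigenvalue computations. -/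
def Cmd.Straight : Cmd → Bool
  | .setN _ _ => true
  | .setR _ _ => true
  | .seq P Q => P.Straight && Q.Straight
  | .ite _ P Q => P.Straight && Q.Straight
  | .loop _ _ => false
  | .eig _ _ _ _ => false

open Classical in
/-- The state after the execution of a program without loops. -/
def Cmd.exec : Cmd → State → State
  | .setN a e, s => ⟨Function.update s.nat (a.eval s) (e.eval s), s.real⟩
  | .setR a e, s => ⟨s.nat, Function.update s.real (a.eval s) (e.eval s)⟩
  | .seq P Q, s => Q.exec (P.exec s)
  | .ite c P Q, s => if c.Holds s then P.exec s else Q.exec s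
  | .loop _ _, s => s
  | .eig _ _ _ _, s => s

/-- A bound for the time of a program without loops. -/
def Cmd.straightCost : Cmd → ℕ
  | .setN a e => a.cost + e.cost + 1
  | .setR a e => a.cost + e.cost + 1
  | .seq P Q => P.straightCost + Q.straightCost
  | .ite c P Q => c.cost + (P.straightCost + Q.straightCost)
  | .loop _ _ => 0
  | .eig _ _ _ _ => 0

/-- Loop-free code is verified by computation: `exec` replaces the run relation, and `straightCost`
does not depend on the state, so it can be evaluated and compared with a generous round constant. -/
theorem Ends.straight {O : Eigensolver} {P : Cmd} {s : State} {T : ℕ} {Q : State → Prop}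
    (hP : P.Straight = true) (hT : P.straightCost ≤ T) (hQ : Q (P.exec s)) :
    Ends O P s T Q := by
  have key : ∀ (P : Cmd) (s : State), P.Straight = true →
      Ends O P s P.straightCost (fun s' => s' = P.exec s) := by
    intro P
    induction P with
    | setN a e => exact fun s _ => ⟨_, _, .setN a e s, le_rfl, rfl⟩
    | setR a e => exact fun s _ => ⟨_, _, .setR a e s, le_rfl, rfl⟩
    | seq P Q ihP ihQ =>
      intro s h
      simp only [Cmd.Straight, Bool.and_eq_true] at h
      refine (ihP s h.1).seq fun s' hs' => ?_
      subst hs'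
      exact ihQ _ h.2
    | ite c P Q ihP ihQ =>
      intro s h
      simp only [Cmd.Straight, Bool.and_eq_true] at h
      refine Ends.ite (fun hc => ?_) (fun hc => ?_)
      · refine (ihP s h.1).mono (Nat.le_add_right _ _) fun s' hs' => ?_
        rw [hs', Cmd.exec, if_pos hc]
      · refine (ihQ s h.2).mono (Nat.le_add_left _ _) fun s' hs' => ?_
        rw [hs', Cmd.exec, if_neg hc]
    | loop c P _ => intro s h; cases h
    | eig src m r dst => intro s h; cases h
  exact (key P s hP).mono hT fun s' hs' => hs' ▸ hQ

/-! ### The quantities computed by the algorithm -/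

/-- The `j`-th coordinate of the `t`-th vector of the grid `{-N, …, N}^d`. -/
def gridCoord (N t j : ℕ) : ℝ := ((t / (2 * N + 1) ^ j % (2 * N + 1) : ℕ) : ℝ) - N

/-- The squared norm of the `t`-th grid vector. -/
def gridNormSq (d N t : ℕ) : ℝ := ∑ j ∈ Finset.range d, gridCoord N t j * gridCoord N t j

/-- The combination of the vectors `√(lam j) • v j` given by the `t`-th grid vector. -/
def gridComb (d N : ℕ) (lam : ℕ → ℝ) (v : ℕ → ℕ → ℝ) (t l : ℕ) : ℝ :=
  ∑ j ∈ Finset.range d, gridCoord N t j * √(lam j) * v j l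

/-- The entry `w i` precedes `w l` in the order by decreasing squares; ties are broken by the
index. -/
def Precedes (w : ℕ → ℝ) (i l : ℕ) : Prop :=
  if i < l then ¬ w i * w i < w l * w l else w l * w l < w i * w i

open Classical in
/-- The number of the first `m` entries of `w` that precede `w l`. -/
def rank (m : ℕ) (w : ℕ → ℝ) (l : ℕ) : ℕ := ((Finset.range m).filter (Precedes w · l)).card

/-- The sum of the squares of those of the first `m` entries of `w` that are among the `k` largest
of its first `n` entries. -/
def topSum (n k : ℕ) (w : ℕ → ℝ) (m : ℕ) : ℝ :=
  ∑ l ∈ Finset.range m, if rank n w l < k then w l * w l else 0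

open Classical in
/-- The number of zeros among those of the first `m` entries of `w` that are among the `k` largest
of its first `n` entries. -/
def topZeros (n k : ℕ) (w : ℕ → ℝ) (m : ℕ) : ℕ :=
  ∑ l ∈ Finset.range m, if rank n w l < k then if 0 < w l * w l then 0 else 1 else 0

/-- The value `W / Q` attached to the `t`-th grid vector. -/
def score (n k d N : ℕ) (lam : ℕ → ℝ) (v : ℕ → ℕ → ℝ) (t : ℕ) : ℝ :=
  topSum n k (gridComb d N lam v t) n / gridNormSq d N t

/-- The value that replaces zeros among the `k` largest entries of `w`. -/
def filler (n k : ℕ) (r : ℝ) (w : ℕ → ℝ) : ℝ := √(topSum n k w n * r / (2 * n))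

/-- The norm of the vector of the `k` largest entries of `w`, with zeros replaced by `filler`. -/
def filledNorm (n k : ℕ) (r : ℝ) (w : ℕ → ℝ) : ℝ :=
  √(topSum n k w n + topZeros n k w n * (filler n k r w * filler n k r w))

open Classical in
/-- The unit vector in the direction of the vector of the `k` largest entries of `w`, with zeros
replaced by `filler`. -/
def truncation (n k : ℕ) (r : ℝ) (w : ℕ → ℝ) (l : ℕ) : ℝ :=
  if rank n w l < k then
    if 0 < w l * w l then w l / filledNorm n k r w else filler n k r w / filledNorm n k r w
  else 0

/-! ### The program -/

/-- The content of a natural number register. -/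
abbrev reg (a : ℕ) : NExp := .cell (.const a)

/-- The address of a real scalar. -/
abbrev scalarAddr (c : ℕ) : NExp := .add (reg 0) (.const c)

/-- The address of an entry of the vector `w`. -/
abbrev wAddr (l : NExp) : NExp := .add (.add (reg 0) (.const 10)) l

/-- The square of an entry of the vector `w`. -/
abbrev wSq (l : NExp) : RExp := .mul (.cell (wAddr l)) (.cell (wAddr l))

/-- The address of an eigenvalue. -/
abbrev lamAddr (j : NExp) : NExp := .add (.add (.add (reg 0) (reg 0)) (.const 10)) j

/-- Increment of a register. -/
abbrev incr (a : ℕ) : Cmd := .setN (.const a) (.add (reg a) (.const 1))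

/-- The empty program. -/
abbrev skip : Cmd := .setN (.const 13) (.const 0)

/-- Registers: 0 to 4 hold `n`, `k`, `d`, `N` and the index `t` of the grid vector; 5 and 7 serve
the division, 6 counts eigenvectors, 8 and 9 count entries, 10 is a rank, 11 counts zeros, 12 is the
address of the current eigenvector, 13 is a dummy, and `20 + l` keeps the rank of entry `l`. Real
cells: the output lies below `n`; the best score, the numerator and denominator of the current
score, the filler and the norm are at `n`, …, `n + 4`; `w` starts at `n + 10`, the eigenvalues at
`2n + 10`, and the eigenvectors follow. The input matrix is overwritten, since nothing after the
eigensolver reads it. -/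
def uniformStep : Cmd :=
  .seq (.ite (.natLt (reg 8) (reg 1))
    (.setR (reg 8) (.div (.const 1) (.sqrt (.ofNat (reg 1))))) (.setR (reg 8) (.const 0)))
  (incr 8)

def uniformLoop : Cmd := .loop (.natLt (reg 8) (reg 0)) uniformStep

/-- Finds the least `N` with `N λ_{d+1} ≥ 2 d λ_1`. The program is not told `α`, `δ` or `ε`; the
resolution of the grid is read off from the eigenvalues. -/
def gridLoop : Cmd :=
  .loop (.realLt (.mul (.ofNat (reg 3)) (.cell (lamAddr (reg 2))))
      (.mul (.mul (.const 2) (.ofNat (reg 2))) (.cell (lamAddr (.const 0))))) (incr 3)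

def clearStep : Cmd := .seq (.setR (wAddr (reg 8)) (.const 0)) (incr 8)

def clearLoop : Cmd := .loop (.natLt (reg 8) (reg 0)) clearStep

/-- Division by `2N + 1` through repeated subtraction, as expressions for natural numbers have no
division. The remainder, which is the next digit of `t`, ends up in register 5 and the quotient in
register 7. -/
def divStep : Cmd :=
  .seq (.setN (.const 5) (.sub (reg 5) (.add (.add (reg 3) (reg 3)) (.const 1)))) (incr 7)

def divLoop : Cmd := .loop (.natLt (.add (reg 3) (reg 3)) (reg 5)) divStep

abbrev coordExp : RExp := .sub (.ofNat (reg 5)) (.ofNat (reg 3))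

def accStep : Cmd :=
  .seq (.setR (wAddr (reg 8)) (.add (.cell (wAddr (reg 8)))
    (.mul (.mul coordExp (.sqrt (.cell (lamAddr (reg 6))))) (.cell (.add (reg 12) (reg 8))))))
  (incr 8)

def accLoop : Cmd := .loop (.natLt (reg 8) (reg 0)) accStep

def combPre : Cmd :=
  .seq (.setR (scalarAddr 2) (.add (.cell (scalarAddr 2)) (.mul coordExp coordExp)))
    (.setN (.const 8) (.const 0))

/-- Register 12 advances by `n` from one eigenvector to the next, because addresses cannot be
computed by multiplication. -/
def combPost : Cmd :=
  .seq (.setN (.const 5) (reg 7)) (.seq (.setN (.const 12) (.add (reg 12) (reg 0))) (incr 6))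

def combStep : Cmd :=
  .seq (.setN (.const 7) (.const 0)) (.seq divLoop (.seq combPre (.seq accLoop combPost)))

def combLoop : Cmd := .loop (.natLt (reg 6) (reg 2)) combStep

def rankStep : Cmd :=
  .seq (.ite (.natLt (reg 9) (reg 8))
      (.ite (.realLt (wSq (reg 9)) (wSq (reg 8))) skip (incr 10))
      (.ite (.realLt (wSq (reg 8)) (wSq (reg 9))) (incr 10) skip))
    (incr 9)

def rankLoop : Cmd := .loop (.natLt (reg 9) (reg 0)) rankStep

def topPre : Cmd := .seq (.setN (.const 10) (.const 0)) (.setN (.const 9) (.const 0))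

def topPost : Cmd :=
  .seq (.setN (.add (.const 20) (reg 8)) (reg 10))
    (.seq (.ite (.natLt (reg 10) (reg 1))
        (.seq (.setR (scalarAddr 1) (.add (.cell (scalarAddr 1)) (wSq (reg 8))))
          (.ite (.realLt (.const 0) (wSq (reg 8))) skip (incr 11)))
        skip)
      (incr 8))

def topStep : Cmd := .seq topPre (.seq rankLoop topPost)

def topLoop : Cmd := .loop (.natLt (reg 8) (reg 0)) topStep

def outStep : Cmd :=
  .seq (.ite (.natLt (.cell (.add (.const 20) (reg 8))) (reg 1))
      (.ite (.realLt (.const 0) (wSq (reg 8)))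
        (.setR (reg 8) (.div (.cell (wAddr (reg 8))) (.cell (scalarAddr 4))))
        (.setR (reg 8) (.div (.cell (scalarAddr 3)) (.cell (scalarAddr 4)))))
      (.setR (reg 8) (.const 0)))
    (incr 8)

def outLoop : Cmd := .loop (.natLt (reg 8) (reg 0)) outStep

abbrev scoreExp : RExp := .div (.cell (scalarAddr 1)) (.cell (scalarAddr 2))

def outPre : Cmd :=
  .seq (.setR (scalarAddr 0) scoreExp)
    (.seq (.setR (scalarAddr 3) (.sqrt (.div (.mul (.cell (scalarAddr 1))
        (.div (.cell (lamAddr (reg 2))) (.cell (lamAddr (.const 0)))))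
        (.mul (.const 2) (.ofNat (reg 0))))))
      (.seq (.setR (scalarAddr 4) (.sqrt (.add (.cell (scalarAddr 1))
          (.mul (.ofNat (reg 11)) (.mul (.cell (scalarAddr 3)) (.cell (scalarAddr 3)))))))
        (.setN (.const 8) (.const 0))))

def bodyPre : Cmd :=
  .seq (.setN (.const 5) (reg 4)) (.seq (.setN (.const 6) (.const 0))
    (.seq (.setN (.const 12) (lamAddr (.add (reg 2) (.const 1))))
      (.seq (.setR (scalarAddr 2) (.const 0)) (.setN (.const 8) (.const 0)))))

def bodyMid : Cmd :=
  .seq (.setR (scalarAddr 1) (.const 0))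
    (.seq (.setN (.const 11) (.const 0)) (.setN (.const 8) (.const 0)))

def body : Cmd :=
  .seq bodyPre (.seq clearLoop (.seq combLoop (.seq bodyMid (.seq topLoop
    (.seq (.ite (.realLt (.cell (scalarAddr 0)) scoreExp) (.seq outPre outLoop) skip)
      (incr 4))))))

/-- After the pass for `t`, register 5 contains `t / (2N + 1)^d`, the quotient left over when `d`
digits have been split off. It becomes positive at `t = (2N + 1)^d`, so the size of the grid never
has to be computed; one superfluous pass is made. -/
def mainLoop : Cmd := .loop (.natLt (reg 5) (.const 1)) body

/-- The algorithm. -/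
def program : Cmd :=
  .ite (.natLt (reg 2) (.const 1)) uniformLoop
    (.seq (.eig (.const 0) (reg 0) (.add (reg 2) (.const 1)) (lamAddr (.const 0)))
      (.seq gridLoop (.seq (.setR (scalarAddr 0) (.const 0)) mainLoop)))

/-! ### Correctness and running time of the program -/

/-- The part of the memory that the main loop leaves unchanged. -/
structure Env (n k d N : ℕ) (lam : ℕ → ℝ) (v : ℕ → ℕ → ℝ) (s : State) : Prop where
  hn : s.nat 0 = n
  hk : s.nat 1 = k
  hd : s.nat 2 = d
  hN : s.nat 3 = N
  hlam : ∀ j ≤ d, s.real (n + n + 10 + j) = lam j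
  hvec : ∀ j ≤ d, ∀ l < n, s.real (n + n + 10 + (d + 1) + j * n + l) = v j l

theorem Env.congr {n k d N : ℕ} {lam : ℕ → ℝ} {v : ℕ → ℕ → ℝ} {s s' : State}
    (h : Env n k d N lam v s) (hnat : ∀ a < 4, s'.nat a = s.nat a)
    (hreal : ∀ a, n + n + 10 ≤ a → s'.real a = s.real a) : Env n k d N lam v s' where
  hn := by rw [hnat 0 (by omega), h.hn]
  hk := by rw [hnat 1 (by omega), h.hk]
  hd := by rw [hnat 2 (by omega), h.hd]
  hN := by rw [hnat 3 (by omega), h.hN]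
  hlam j hj := by rw [hreal _ (by omega), h.hlam j hj]
  hvec j hj l hl := by
    rw [hreal _ (by omega), h.hvec j hj l hl]

variable {O : Eigensolver} {n k d N : ℕ} {lam : ℕ → ℝ} {v : ℕ → ℕ → ℝ}

/-! ### Specifications of the loops -/

theorem ends_clearLoop {s : State} (h0 : s.nat 0 = n) (h8 : s.nat 8 = 0) :
    Ends O clearLoop s (n * 50 + 50) fun s' =>
      (∀ a, a ≠ 8 → s'.nat a = s.nat a) ∧ (∀ l < n, s'.real (n + 10 + l) = 0) ∧
      (∀ a, (a < n + 10 ∨ n + n + 10 ≤ a) → s'.real a = s.real a) := by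
  refine (Ends.loop (T := 30) (m := n) (I := fun i s' => s'.nat 8 = i ∧
      (∀ a, a ≠ 8 → s'.nat a = s.nat a) ∧ (∀ l < i, s'.real (n + 10 + l) = 0) ∧
      (∀ a, (a < n + 10 ∨ n + n + 10 ≤ a) → s'.real a = s.real a)) ?_ ?_ ?_).mono ?_ ?_
  · rintro i hi s' ⟨h1, h2, h3, h4⟩
    have hn : s'.nat 0 = n := by rw [h2 0 (by omega), h0]
    refine ⟨by simp [Cond.Holds, NExp.eval, h1, hn, hi], Ends.straight (by decide) (by decide) ?_⟩
    simp only [clearStep, Cmd.exec, NExp.eval, RExp.eval, h1, hn, Function.update_apply]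
    refine ⟨by simp, fun a ha => by simp [ha, h2 a ha], fun l hl => ?_, fun a ha => ?_⟩
    · split_ifs with h
      · simp
      · exact h3 l (by omega)
    · rw [if_neg (by omega), h4 a ha]
  · rintro s' ⟨h1, h2, -⟩
    have hn : s'.nat 0 = n := by rw [h2 0 (by omega), h0]
    simp [Cond.Holds, NExp.eval, h1, hn]
  · exact ⟨h8, fun _ _ => rfl, by simp, fun _ _ => rfl⟩
  · simp only [Cond.cost, NExp.cost]; omega
  · rintro s' ⟨-, h⟩
    exact h

theorem ends_divLoop {s : State} (h3 : s.nat 3 = N) (h7 : s.nat 7 = 0) :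
    Ends O divLoop s (s.nat 5 * 50 + 50) fun s' =>
      (∀ a, a ≠ 5 → a ≠ 7 → s'.nat a = s.nat a) ∧ s'.real = s.real ∧
      s'.nat 5 = s.nat 5 % (2 * N + 1) ∧ s'.nat 7 = s.nat 5 / (2 * N + 1) := by
  set u := s.nat 5 with hu
  have hdm := Nat.mod_add_div u (2 * N + 1)
  have hml := Nat.mod_lt u (show 2 * N + 1 > 0 by omega)
  refine (Ends.loop (T := 30) (m := u / (2 * N + 1)) (I := fun i s' =>
      (∀ a, a ≠ 5 → a ≠ 7 → s'.nat a = s.nat a) ∧ s'.real = s.real ∧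
      s'.nat 5 + (2 * N + 1) * i = u ∧ s'.nat 7 = i) ?_ ?_ ?_).mono ?_ ?_
  · rintro i hi s' ⟨h1, h2, h5, h8⟩
    have hN : s'.nat 3 = N := by rw [h1 3 (by omega) (by omega), h3]
    have h9 : (2 * N + 1) * (i + 1) ≤ (2 * N + 1) * (u / (2 * N + 1)) := Nat.mul_le_mul_left _ hi
    rw [Nat.mul_succ] at h9
    refine ⟨by simp only [Cond.Holds, NExp.eval, hN]; omega,
      Ends.straight (by decide) (by decide) ?_⟩
    simp only [divStep, Cmd.exec, NExp.eval, h8, hN, Function.update_apply]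
    refine ⟨fun a ha hb => by simp [ha, hb, h1 a ha hb], h2, ?_, by simp⟩
    simp only [Nat.mul_succ]
    norm_num
    omega
  · rintro s' ⟨h1, -, h5, -⟩
    have hN : s'.nat 3 = N := by rw [h1 3 (by omega) (by omega), h3]
    simp only [Cond.Holds, NExp.eval, hN]
    omega
  · exact ⟨fun _ _ _ => rfl, rfl, by simp [hu], h7⟩
  · simp only [Cond.cost, NExp.cost]
    have := Nat.div_le_self u (2 * N + 1)
    omega
  · rintro s' ⟨h1, h2, h5, h8⟩
    exact ⟨h1, h2, by omega, h8⟩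

theorem ends_accLoop {s : State} (hs : Env n k d N lam v s) {j : ℕ} (hj : j < d)
    (h6 : s.nat 6 = j) (h8 : s.nat 8 = 0) (h12 : s.nat 12 = n + n + 10 + (d + 1) + j * n) :
    Ends O accLoop s (n * 100 + 100) fun s' =>
      (∀ a, a ≠ 8 → s'.nat a = s.nat a) ∧
      (∀ l < n, s'.real (n + 10 + l) = s.real (n + 10 + l) +
        ((s.nat 5 : ℝ) - N) * √(lam j) * v j l) ∧
      (∀ a, (a < n + 10 ∨ n + n + 10 ≤ a) → s'.real a = s.real a) := by
  refine (Ends.loop (T := 70) (m := n) (I := fun i s' => s'.nat 8 = i ∧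
      (∀ a, a ≠ 8 → s'.nat a = s.nat a) ∧ (∀ l < n, s'.real (n + 10 + l) = s.real (n + 10 + l) +
        if l < i then ((s.nat 5 : ℝ) - N) * √(lam j) * v j l else 0) ∧
      (∀ a, (a < n + 10 ∨ n + n + 10 ≤ a) → s'.real a = s.real a)) ?_ ?_ ?_).mono ?_ ?_
  · rintro i hi s' ⟨h1, h2, h3, h4⟩
    have hE : Env n k d N lam v s' :=
      hs.congr (fun a ha => h2 a (by omega)) (fun a ha => h4 a (.inr ha))
    refine ⟨by simp [Cond.Holds, NExp.eval, h1, hE.hn, hi],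
      Ends.straight (by decide) (by decide) ?_⟩
    have e6 : s'.nat 6 = j := by rw [h2 6 (by omega), h6]
    have e12 : s'.nat 12 = n + n + 10 + (d + 1) + j * n := by rw [h2 12 (by omega), h12]
    simp only [accStep, Cmd.exec, NExp.eval, RExp.eval, h1, hE.hn, hE.hN, e6, e12,
      hE.hlam j hj.le, hE.hvec j hj.le i hi, Function.update_apply, h2 5 (by omega)]
    refine ⟨by simp, fun a ha => by simp [ha, h2 a ha], fun l hl => ?_, fun a ha => ?_⟩
    · split_ifs with h h' h'
      · obtain rfl : l = i := by omega
        rw [h3 l hl]; simp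
      · omega
      · rw [h3 l hl, if_pos (by omega)]
      · rw [h3 l hl, if_neg (by omega)]
    · rw [if_neg (by omega), h4 a ha]
  · rintro s' ⟨h1, h2, -⟩
    have hn : s'.nat 0 = n := by rw [h2 0 (by omega), hs.hn]
    simp [Cond.Holds, NExp.eval, h1, hn]
  · exact ⟨h8, fun _ _ => rfl, by simp, fun _ _ => rfl⟩
  · simp only [Cond.cost, NExp.cost]; omega
  · rintro s' ⟨-, h1, h2, h3⟩
    exact ⟨h1, fun l hl => by rw [h2 l hl, if_pos hl], h3⟩

/-- The grid vector is given by the digits of `t` in base `2N + 1`, shifted by `N`. The digits are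
consumed from the lowest one on, with `t / (2N + 1)^j` in register 5 before round `j`. Splitting off
a digit takes time proportional to `t`, which is harmless because `t` is bounded independently of
`n`. -/
theorem ends_combLoop {s : State} (hs : Env n k d N lam v s) {t : ℕ} (h5 : s.nat 5 = t)
    (h6 : s.nat 6 = 0) (h12 : s.nat 12 = n + n + 10 + (d + 1)) (hQ : s.real (n + 2) = 0)
    (hw : ∀ l < n, s.real (n + 10 + l) = 0) :
    Ends O combLoop s (d * (n * 100 + t * 50 + 300) + 10) fun s' =>
      (∀ a, a < 5 → s'.nat a = s.nat a) ∧ s'.nat 5 = t / (2 * N + 1) ^ d ∧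
      s'.real (n + 2) = gridNormSq d N t ∧
      (∀ l < n, s'.real (n + 10 + l) = gridComb d N lam v t l) ∧
      (∀ a, (a < n + 10 ∨ n + n + 10 ≤ a) → a ≠ n + 2 → s'.real a = s.real a) := by
  refine (Ends.loop (T := n * 100 + t * 50 + 290) (m := d) (I := fun j s' =>
      s'.nat 6 = j ∧ s'.nat 12 = n + n + 10 + (d + 1) + j * n ∧
      (∀ a, a < 5 → s'.nat a = s.nat a) ∧ s'.nat 5 = t / (2 * N + 1) ^ j ∧
      s'.real (n + 2) = gridNormSq j N t ∧
      (∀ l < n, s'.real (n + 10 + l) = gridComb j N lam v t l) ∧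
      (∀ a, (a < n + 10 ∨ n + n + 10 ≤ a) → a ≠ n + 2 → s'.real a = s.real a))
      ?_ ?_ ?_).mono ?_ ?_
  · rintro j hj s1 ⟨h61, h121, hr1, h51, hQ1, hw1, hreal1⟩
    have hE1 : Env n k d N lam v s1 :=
      hs.congr (fun a ha => hr1 a (by omega)) (fun a ha => hreal1 a (.inr ha) (by omega))
    refine ⟨by simp [Cond.Holds, NExp.eval, h61, hE1.hd, hj], ?_⟩
    refine Ends.mono (T := 10 + (t * 50 + 50 + (60 + (n * 100 + 100 + 60)))) ?_ (by omega)
      (fun _ h => h)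
    refine Ends.seq (Q := fun s2 => (∀ a, a ≠ 7 → s2.nat a = s1.nat a) ∧ s2.nat 7 = 0 ∧
      s2.real = s1.real) (Ends.straight (by decide) (by decide) ?_) ?_
    · simp only [Cmd.exec, NExp.eval, Function.update_apply]
      exact ⟨fun a ha => by simp [ha], by simp, trivial⟩
    rintro s2 ⟨hr2, h72, hreal2⟩
    have h52 : s2.nat 5 = t / (2 * N + 1) ^ j := by rw [hr2 5 (by omega), h51]
    refine Ends.seq ((ends_divLoop (N := N) (by rw [hr2 3 (by omega), hE1.hN]) h72).mono ?_
      (fun _ h => h)) ?_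
    · have := Nat.div_le_self t ((2 * N + 1) ^ j)
      omega
    rintro s3 ⟨hr3, hreal3, h53, h73⟩
    rw [h52] at h53 h73
    have hr31 : ∀ a, a ≠ 5 → a ≠ 7 → s3.nat a = s1.nat a := fun a ha hb => by
      rw [hr3 a ha hb, hr2 a hb]
    have e0 : s3.nat 0 = n := by rw [hr31 0 (by omega) (by omega), hE1.hn]
    have e3 : s3.nat 3 = N := by rw [hr31 3 (by omega) (by omega), hE1.hN]
    refine Ends.seq (Q := fun s4 => (∀ a, a ≠ 8 → s4.nat a = s3.nat a) ∧ s4.nat 8 = 0 ∧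
      s4.real (n + 2) = gridNormSq (j + 1) N t ∧ ∀ a, a ≠ n + 2 → s4.real a = s1.real a)
      (Ends.straight (by decide) (by decide) ?_) ?_
    · simp only [combPre, Cmd.exec, NExp.eval, RExp.eval, Function.update_apply, e0, e3]
      refine ⟨fun a ha => by simp [ha], by simp, ?_, fun a ha => by simp [ha, hreal3, hreal2]⟩
      rw [if_pos trivial, hreal3, hreal2, hQ1, h53, gridNormSq, gridNormSq, Finset.sum_range_succ]
      rfl
    rintro s4 ⟨hr4, h84, hQ4, hreal4⟩
    have hr41 : ∀ a, a ≠ 5 → a ≠ 7 → a ≠ 8 → s4.nat a = s1.nat a := fun a ha hb hc => by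
      rw [hr4 a hc, hr31 a ha hb]
    have hE4 : Env n k d N lam v s4 :=
      hE1.congr (fun a ha => hr41 a (by omega) (by omega) (by omega))
        (fun a ha => hreal4 a (by omega))
    refine Ends.seq (ends_accLoop hE4 hj (by rw [hr41 6 (by omega) (by omega) (by omega), h61])
      h84 (by rw [hr41 12 (by omega) (by omega) (by omega), h121])) ?_
    rintro s5 ⟨hr5, hw5, hreal5⟩
    refine Ends.straight (by decide) (by decide) ?_
    have hr51 : ∀ a, a ≠ 5 → a ≠ 7 → a ≠ 8 → s5.nat a = s1.nat a := fun a ha hb hc => by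
      rw [hr5 a hc, hr41 a ha hb hc]
    have e50 : s5.nat 0 = n := by rw [hr51 0 (by omega) (by omega) (by omega), hE1.hn]
    have e57 : s5.nat 7 = t / (2 * N + 1) ^ j / (2 * N + 1) := by
      rw [hr5 7 (by omega), hr4 7 (by omega), h73]
    simp only [combPost, Cmd.exec, NExp.eval, Function.update_apply]
    refine ⟨?_, ?_, fun a ha => ?_, ?_, ?_, fun l hl => ?_, fun a ha hb => ?_⟩
    · simp [hr51 6 (by omega) (by omega) (by omega), h61]
    · simp [hr51 12 (by omega) (by omega) (by omega), h121, e50]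
      ring
    · rw [if_neg (by omega), if_neg (by omega), if_neg (by omega),
        hr51 a (by omega) (by omega) (by omega), hr1 a ha]
    · simp [e57, Nat.div_div_eq_div_mul, pow_succ]
    · rw [hreal5 _ (.inl (by omega)), hQ4]
    · rw [hw5 l hl, hreal4 _ (by omega), hw1 l hl, hr4 5 (by omega), h53, gridComb, gridComb,
        Finset.sum_range_succ]
      rfl
    · rw [hreal5 a ha, hreal4 a hb, hreal1 a ha hb]
  · rintro s' ⟨h1, h2, h3, -⟩
    simp [Cond.Holds, NExp.eval, h1, h3 2 (by omega), hs.hd]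
  · refine ⟨h6, by rw [h12]; simp, fun _ _ => rfl, by simp [h5], by simp [gridNormSq, hQ],
      fun l hl => by simp [gridComb, hw l hl], fun _ _ _ => rfl⟩
  · simp only [Cond.cost, NExp.cost]
    rw [show n * 100 + t * 50 + 290 + (1 + 1 + (1 + 1) + 1) = n * 100 + t * 50 + 295 by ring]
    gcongr <;> omega
  · rintro s' ⟨-, -, h1⟩
    exact h1

theorem rank_succ (w : ℕ → ℝ) (l m : ℕ) [Decidable (Precedes w m l)] :
    rank (m + 1) w l = rank m w l + if Precedes w m l then 1 else 0 := by
  rw [rank, Finset.range_add_one, Finset.filter_insert]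
  split_ifs
  · rw [Finset.card_insert_of_notMem (by simp), rank]
  · rw [rank, add_zero]

theorem ends_rankLoop {s : State} (h0 : s.nat 0 = n) {w : ℕ → ℝ}
    (hw : ∀ l < n, s.real (n + 10 + l) = w l) {l : ℕ} (hl : l < n) (h8 : s.nat 8 = l)
    (h9 : s.nat 9 = 0) (h10 : s.nat 10 = 0) :
    Ends O rankLoop s (n * 150 + 10) fun s' =>
      (∀ a, a ≠ 9 → a ≠ 10 → a ≠ 13 → s'.nat a = s.nat a) ∧ s'.real = s.real ∧
      s'.nat 10 = rank n w l := by
  classical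
  refine (Ends.loop (T := 140) (m := n) (I := fun i s' => s'.nat 9 = i ∧
      (∀ a, a ≠ 9 → a ≠ 10 → a ≠ 13 → s'.nat a = s.nat a) ∧ s'.real = s.real ∧
      s'.nat 10 = rank i w l) ?_ ?_ ?_).mono ?_ ?_
  · rintro i hi s' ⟨h1, h2, h3, h4⟩
    have e0 : s'.nat 0 = n := by rw [h2 0 (by omega) (by omega) (by omega), h0]
    have e8 : s'.nat 8 = l := by rw [h2 8 (by omega) (by omega) (by omega), h8]
    refine ⟨by simp [Cond.Holds, NExp.eval, h1, e0, hi],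
      Ends.straight (by decide) (by decide) ?_⟩
    simp only [rankStep, Cmd.exec, NExp.eval, RExp.eval, Cond.Holds, h1, e0, e8, h3, hw i hi,
      hw l hl, rank_succ, Precedes]
    split_ifs <;>
      simp_all
  · rintro s' ⟨h1, h2, -⟩
    have e0 : s'.nat 0 = n := by rw [h2 0 (by omega) (by omega) (by omega), h0]
    simp [Cond.Holds, NExp.eval, h1, e0]
  · exact ⟨h9, fun _ _ _ _ => rfl, rfl, by simp [rank, h10]⟩
  · simp only [Cond.cost, NExp.cost]; omega
  · rintro s' ⟨-, h⟩
    exact h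

theorem topSum_succ (n k : ℕ) (w : ℕ → ℝ) (m : ℕ) : topSum n k w (m + 1) =
    topSum n k w m + if rank n w m < k then w m * w m else 0 :=
  Finset.sum_range_succ _ _

open Classical in
theorem topZeros_succ (n k : ℕ) (w : ℕ → ℝ) (m : ℕ) : topZeros n k w (m + 1) =
    topZeros n k w m + if rank n w m < k then if 0 < w m * w m then 0 else 1 else 0 :=
  Finset.sum_range_succ _ _

theorem ends_topLoop {s : State} (h0 : s.nat 0 = n) (h1 : s.nat 1 = k) {w : ℕ → ℝ}
    (hw : ∀ l < n, s.real (n + 10 + l) = w l) (h8 : s.nat 8 = 0) (h11 : s.nat 11 = 0)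
    (hW : s.real (n + 1) = 0) :
    Ends O topLoop s (n * (n * 150 + 200) + 10) fun s' =>
      (∀ a, a < 8 → s'.nat a = s.nat a) ∧ (∀ a, a ≠ n + 1 → s'.real a = s.real a) ∧
      (∀ l < n, s'.nat (20 + l) = rank n w l) ∧ s'.nat 11 = topZeros n k w n ∧
      s'.real (n + 1) = topSum n k w n := by
  classical
  refine (Ends.loop (T := n * 150 + 190) (m := n) (I := fun i s' => s'.nat 8 = i ∧
      (∀ a, a < 8 → s'.nat a = s.nat a) ∧ (∀ a, a ≠ n + 1 → s'.real a = s.real a) ∧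
      (∀ l < i, s'.nat (20 + l) = rank n w l) ∧ s'.nat 11 = topZeros n k w i ∧
      s'.real (n + 1) = topSum n k w i) ?_ ?_ ?_).mono ?_ ?_
  · rintro i hi s1 ⟨h81, hr1, hreal1, hrk1, hz1, hW1⟩
    have e10 : s1.nat 0 = n := by rw [hr1 0 (by omega), h0]
    refine ⟨by simp [Cond.Holds, NExp.eval, h81, e10, hi], ?_⟩
    refine Ends.mono (T := 10 + (n * 150 + 10 + 120)) ?_ (by omega) (fun _ h => h)
    refine Ends.seq (Q := fun s2 => (∀ a, a ≠ 9 → a ≠ 10 → s2.nat a = s1.nat a) ∧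
      s2.nat 9 = 0 ∧ s2.nat 10 = 0 ∧ s2.real = s1.real)
      (Ends.straight (by decide) (by decide) ?_) ?_
    · simp only [topPre, Cmd.exec, NExp.eval, Function.update_apply]
      exact ⟨fun a ha hb => by simp [ha, hb], by simp, by simp, trivial⟩
    rintro s2 ⟨hr2, h92, h102, hreal2⟩
    have hw2 : ∀ l < n, s2.real (n + 10 + l) = w l := fun l hl => by
      rw [hreal2, hreal1 _ (by omega), hw l hl]
    refine Ends.seq (ends_rankLoop (by rw [hr2 0 (by omega) (by omega), e10]) hw2 hi
      (by rw [hr2 8 (by omega) (by omega), h81]) h92 h102) ?_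
    rintro s3 ⟨hr3, hreal3, h103⟩
    have hr31 : ∀ a, a ≠ 9 → a ≠ 10 → a ≠ 13 → s3.nat a = s1.nat a := fun a ha hb hc => by
      rw [hr3 a ha hb hc, hr2 a ha hb]
    have e8 : s3.nat 8 = i := by rw [hr31 8 (by omega) (by omega) (by omega), h81]
    have e0 : s3.nat 0 = n := by rw [hr31 0 (by omega) (by omega) (by omega), e10]
    have e1 : s3.nat 1 = k := by
      rw [hr31 1 (by omega) (by omega) (by omega), hr1 1 (by omega), h1]
    have e11 : s3.nat 11 = topZeros n k w i := by
      rw [hr31 11 (by omega) (by omega) (by omega), hz1]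
    have ew : s3.real (n + 10 + i) = w i := by rw [hreal3, hw2 i hi]
    have eW : s3.real (n + 1) = topSum n k w i := by rw [hreal3, hreal2, hW1]
    have er : ∀ a, a ≠ n + 1 → s3.real a = s.real a := fun a ha => by
      rw [hreal3, hreal2, hreal1 a ha]
    have en : ∀ a < 8, s3.nat a = s.nat a := fun a ha => by
      rw [hr31 a (by omega) (by omega) (by omega), hr1 a ha]
    have ek : ∀ l < i, s3.nat (20 + l) = rank n w l := fun l hl => by
      rw [hr31 _ (by omega) (by omega) (by omega), hrk1 l hl]
    refine Ends.straight (by decide) (by decide) ?_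
    -- The table of ranks starts at register 20 and so cannot collide with the working registers.
    have hne : ∀ c : ℕ, c < 20 → c ≠ 20 + i := fun c hc => by omega
    have hne' : n + 10 + i ≠ n + 1 := by omega
    by_cases hk : rank n w i < k <;> by_cases hp : 0 < w i * w i
    all_goals
      simp only [topPost, Cmd.exec, NExp.eval, RExp.eval, Cond.Holds, e8, e0, e1, h103,
        Function.update_apply, hne 10 (by omega), hne 1 (by omega), hne 8 (by omega),
        hne 0 (by omega), hne 11 (by omega), if_false, if_true, ew, eW, e11, topSum_succ,
        topZeros_succ, Rat.cast_zero, hk, hp, hne']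
      refine ⟨by simp, fun a ha => ?_, fun a ha => by simp [ha, er a ha], fun l hl => ?_,
        by simp, by simp⟩
      · rw [← en a ha]
        split_ifs <;> first | rfl | omega
      · rcases Nat.lt_succ_iff_lt_or_eq.mp hl with h | rfl
        · rw [← ek l h]
          split_ifs <;> first | rfl | omega
        · split_ifs <;> first | rfl | omega
  · rintro s' ⟨h81, hr1, -⟩
    have e0 : s'.nat 0 = n := by rw [hr1 0 (by omega), h0]
    simp [Cond.Holds, NExp.eval, h81, e0]
  · exact ⟨h8, fun _ _ => rfl, fun _ _ => rfl, by simp, by simp [topZeros, h11],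
      by simp [topSum, hW]⟩
  · simp only [Cond.cost, NExp.cost]
    rw [show n * 150 + 190 + (1 + 1 + (1 + 1) + 1) = n * 150 + 195 by ring]
    gcongr <;> omega
  · rintro s' ⟨-, h⟩
    exact h

theorem ends_outLoop {s : State} (h0 : s.nat 0 = n) (h1 : s.nat 1 = k) {w : ℕ → ℝ} {r : ℝ}
    (hw : ∀ l < n, s.real (n + 10 + l) = w l) (h8 : s.nat 8 = 0)
    (hrk : ∀ l < n, s.nat (20 + l) = rank n w l) (h3 : s.real (n + 3) = filler n k r w)
    (h4 : s.real (n + 4) = filledNorm n k r w) :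
    Ends O outLoop s (n * 150 + 10) fun s' =>
      (∀ a, a ≠ 8 → s'.nat a = s.nat a) ∧ (∀ a, n ≤ a → s'.real a = s.real a) ∧
      ∀ l < n, s'.real l = truncation n k r w l := by
  classical
  refine (Ends.loop (T := 140) (m := n) (I := fun i s' => s'.nat 8 = i ∧
      (∀ a, a ≠ 8 → s'.nat a = s.nat a) ∧ (∀ a, n ≤ a → s'.real a = s.real a) ∧
      ∀ l < i, s'.real l = truncation n k r w l) ?_ ?_ ?_).mono ?_ ?_
  · rintro i hi s' ⟨e8, hr, hreal, ho⟩
    have e0 : s'.nat 0 = n := by rw [hr 0 (by omega), h0]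
    have e1 : s'.nat 1 = k := by rw [hr 1 (by omega), h1]
    have er : s'.nat (20 + i) = rank n w i := by rw [hr _ (by omega), hrk i hi]
    have ew : s'.real (n + 10 + i) = w i := by rw [hreal _ (by omega), hw i hi]
    have e3 : s'.real (n + 3) = filler n k r w := by rw [hreal _ (by omega), h3]
    have e4 : s'.real (n + 4) = filledNorm n k r w := by rw [hreal _ (by omega), h4]
    refine ⟨by simp [Cond.Holds, NExp.eval, e8, e0, hi],
      Ends.straight (by decide) (by decide) ?_⟩
    have key : Cmd.exec outStep s' = ⟨Function.update s'.nat 8 (i + 1),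
        Function.update s'.real i (truncation n k r w i)⟩ := by
      simp only [outStep, Cmd.exec, NExp.eval, RExp.eval, Cond.Holds, e8, e0, e1, er, ew, e3, e4,
        truncation, Rat.cast_zero]
      split_ifs <;> simp only [e8]
    rw [key]
    refine ⟨by simp, fun a ha => by simp [ha, hr a ha], fun a ha => ?_, fun l hl => ?_⟩
    · simp only [Function.update_apply]
      rw [if_neg (by omega), hreal a ha]
    · rcases Nat.lt_succ_iff_lt_or_eq.mp hl with h | rfl
      · simp only [Function.update_apply]
        rw [if_neg (by omega), ho l h]
      · simp
  · rintro s' ⟨e8, hr, -⟩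
    have e0 : s'.nat 0 = n := by rw [hr 0 (by omega), h0]
    simp [Cond.Holds, NExp.eval, e8, e0]
  · exact ⟨h8, fun _ _ => rfl, fun _ _ => rfl, by simp⟩
  · simp only [Cond.cost, NExp.cost]; omega
  · rintro s' ⟨-, h⟩
    exact h

open Classical in
theorem ends_body {s : State} (hs : Env n k d N lam v s) {t : ℕ} (h4 : s.nat 4 = t) :
    Ends O body s (n * (n * 150 + 400) + d * (n * 100 + t * 50 + 300) + 800) fun s' =>
      Env n k d N lam v s' ∧ s'.nat 4 = t + 1 ∧ s'.nat 5 = t / (2 * N + 1) ^ d ∧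
      if s.real n < score n k d N lam v t then
        s'.real n = score n k d N lam v t ∧
          ∀ l < n, s'.real l = truncation n k (lam d / lam 0) (gridComb d N lam v t) l
      else s'.real n = s.real n ∧ ∀ l < n, s'.real l = s.real l := by
  refine Ends.mono (T := 100 + (n * 50 + 50 + ((d * (n * 100 + t * 50 + 300) + 10) +
    (100 + ((n * (n * 150 + 200) + 10) + ((n * 150 + 260) + 20)))))) ?_ (by
      rw [show n * (n * 150 + 400) = n * (n * 150 + 200) + n * 200 by ring]; omega) (fun _ h => h)
  -- initialization
  refine Ends.seq (Q := fun s1 => (∀ a, a < 5 → s1.nat a = s.nat a) ∧ s1.nat 5 = t ∧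
    s1.nat 6 = 0 ∧ s1.nat 12 = n + n + 10 + (d + 1) ∧ s1.nat 8 = 0 ∧ s1.real (n + 2) = 0 ∧
    ∀ a, a ≠ n + 2 → s1.real a = s.real a) (Ends.straight (by decide) (by decide) ?_) ?_
  · simp only [bodyPre, Cmd.exec, NExp.eval, RExp.eval, Function.update_apply]
    refine ⟨fun a ha => ?_, by simp [h4], by simp, by simp [hs.hn, hs.hd], by simp,
      by simp [hs.hn], fun a ha => by simp [hs.hn, ha]⟩
    simp only [show a ≠ 8 by omega, show a ≠ 12 by omega, show a ≠ 6 by omega,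
      show a ≠ 5 by omega, if_false]
  rintro s1 ⟨hr1, h51, h61, h121, h81, hQ1, hreal1⟩
  have e10 : s1.nat 0 = n := by rw [hr1 0 (by omega), hs.hn]
  refine (ends_clearLoop e10 h81).seq ?_
  rintro s2 ⟨hr2, hw2, hreal2⟩
  have hE2 : Env n k d N lam v s2 := hs.congr
    (fun a ha => by rw [hr2 a (by omega), hr1 a (by omega)])
    (fun a ha => by rw [hreal2 a (.inr ha), hreal1 a (by omega)])
  -- the linear combination
  refine (ends_combLoop hE2 (t := t) (by rw [hr2 5 (by omega), h51])
    (by rw [hr2 6 (by omega), h61]) (by rw [hr2 12 (by omega), h121])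
    (by rw [hreal2 _ (.inl (by omega)), hQ1]) hw2).seq ?_
  rintro s3 ⟨hr3, h53, hQ3, hw3, hreal3⟩
  have hr30 : ∀ a < 5, s3.nat a = s.nat a := fun a ha => by
    rw [hr3 a ha, hr2 a (by omega), hr1 a ha]
  have hreal30 : ∀ a, (a < n + 10 ∨ n + n + 10 ≤ a) → a ≠ n + 2 → s3.real a = s.real a :=
    fun a ha hb => by rw [hreal3 a ha hb, hreal2 a ha, hreal1 a hb]
  have e30 : s3.nat 0 = n := by rw [hr30 0 (by omega), hs.hn]
  refine Ends.seq (Q := fun s4 => (∀ a, a < 8 → s4.nat a = s3.nat a) ∧ s4.nat 8 = 0 ∧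
    s4.nat 11 = 0 ∧ s4.real (n + 1) = 0 ∧ ∀ a, a ≠ n + 1 → s4.real a = s3.real a)
    (Ends.straight (by decide) (by decide) ?_) ?_
  · simp only [bodyMid, Cmd.exec, NExp.eval, RExp.eval, Function.update_apply]
    refine ⟨fun a ha => ?_, by simp, by simp, by simp [e30], fun a ha => by simp [e30, ha]⟩
    simp only [show a ≠ 8 by omega, show a ≠ 11 by omega, if_false]
  rintro s4 ⟨hr4, h84, h114, hW4, hreal4⟩
  -- the largest entries
  set w := gridComb d N lam v t with hwdef
  refine (ends_topLoop (k := k) (by rw [hr4 0 (by omega), e30])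
    (by rw [hr4 1 (by omega), hr30 1 (by omega), hs.hk]) (w := w)
    (fun l hl => by rw [hreal4 _ (by omega), hw3 l hl]) h84 h114 hW4).seq ?_
  rintro s5 ⟨hr5, hreal5, hrk5, h115, hW5⟩
  have hr50 : ∀ a < 5, s5.nat a = s.nat a := fun a ha => by
    rw [hr5 a (by omega), hr4 a (by omega), hr30 a ha]
  have h55 : s5.nat 5 = t / (2 * N + 1) ^ d := by rw [hr5 5 (by omega), hr4 5 (by omega), h53]
  have hreal53 : ∀ a, a ≠ n + 1 → s5.real a = s3.real a := fun a ha => by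
    rw [hreal5 a ha, hreal4 a ha]
  have hreal50 : ∀ a, (a < n + 10 ∨ n + n + 10 ≤ a) → a ≠ n + 2 → a ≠ n + 1 →
      s5.real a = s.real a := fun a ha hb hc => by rw [hreal53 a hc, hreal30 a ha hb]
  have hQ5 : s5.real (n + 2) = gridNormSq d N t := by rw [hreal53 _ (by omega), hQ3]
  have hw5 : ∀ l < n, s5.real (n + 10 + l) = w l := fun l hl => by
    rw [hreal53 _ (by omega), hw3 l hl]
  have hE5 : Env n k d N lam v s5 := hs.congr (fun a ha => hr50 a (by omega))
    (fun a ha => hreal50 a (.inr ha) (by omega) (by omega))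
  have hcond : (Cond.realLt (.cell (scalarAddr 0)) scoreExp).Holds s5 ↔
      s.real n < score n k d N lam v t := by
    simp only [Cond.Holds, RExp.eval, NExp.eval, hE5.hn, add_zero, hW5, hQ5, score,
      hreal50 n (.inl (by omega)) (by omega) (by omega), hwdef]
  -- the output
  refine Ends.seq (Q := fun s6 => (∀ a < 6, s6.nat a = s5.nat a) ∧
    (∀ a, n + 10 ≤ a → s6.real a = s5.real a) ∧
    if s.real n < score n k d N lam v t then
      s6.real n = score n k d N lam v t ∧
        ∀ l < n, s6.real l = truncation n k (lam d / lam 0) w l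
    else s6.real n = s.real n ∧ ∀ l < n, s6.real l = s.real l) ?_ ?_
  · refine Ends.mono (T := 17 + (n * 150 + 200)) ?_ (by omega) (fun _ h => h)
    refine Ends.ite (fun hc => ?_) (fun hc => ?_)
    · rw [hcond] at hc
      simp only [if_pos hc]
      refine Ends.mono (T := 190 + (n * 150 + 10)) ?_ (by omega) (fun _ h => h)
      refine Ends.seq (Q := fun s6 => (∀ a, a ≠ 8 → s6.nat a = s5.nat a) ∧ s6.nat 8 = 0 ∧
        s6.real n = score n k d N lam v t ∧ s6.real (n + 3) = filler n k (lam d / lam 0) w ∧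
        s6.real (n + 4) = filledNorm n k (lam d / lam 0) w ∧
        ∀ a, n + 10 ≤ a → s6.real a = s5.real a) (Ends.straight (by decide) (by decide) ?_) ?_
      · have el : s5.real (n + n + 10) = lam 0 := hE5.hlam 0 (by omega)
        simp only [outPre, Cmd.exec, NExp.eval, RExp.eval, Function.update_apply, hE5.hn,
          hE5.hd, hW5, hQ5, h115, add_zero, hE5.hlam d le_rfl, el, Nat.add_left_cancel_iff,
          show n + n + 10 + d ≠ n by omega, show n + n + 10 ≠ n by omega, if_false, if_true,
          show n + 1 ≠ n by omega, show n ≠ n + 3 by omega,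
          show n ≠ n + 4 by omega]
        refine ⟨fun a ha => by simp [ha], trivial, rfl, ?_, ?_, fun a ha => ?_⟩
        · simp [filler]
        · simp [filledNorm, filler]
        · simp only [show a ≠ n + 4 by omega, show a ≠ n + 3 by omega, show a ≠ n by omega,
            if_false]
      rintro s6 ⟨hr6, h86, hb6, h36, h46, hreal6⟩
      refine (ends_outLoop (by rw [hr6 0 (by omega), hE5.hn]) (by rw [hr6 1 (by omega), hE5.hk])
        (fun l hl => by rw [hreal6 _ (by omega), hw5 l hl]) h86
        (fun l hl => by rw [hr6 _ (by omega), hrk5 l hl]) h36 h46).mono le_rfl ?_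
      rintro s7 ⟨hr7, hreal7, ho7⟩
      exact ⟨fun a ha => by rw [hr7 a (by omega), hr6 a (by omega)],
        fun a ha => by rw [hreal7 a (by omega), hreal6 a ha], by rw [hreal7 n le_rfl, hb6], ho7⟩
    · rw [hcond] at hc
      simp only [if_neg hc]
      refine Ends.straight (by decide) (T := n * 150 + 200) ?_ ?_
      · have : Cmd.straightCost skip ≤ 200 := by decide
        omega
      · simp only [Cmd.exec, NExp.eval]
        exact ⟨fun a ha => Function.update_of_ne (by omega) _ _, fun _ _ => trivial,
          hreal50 n (.inl (by omega)) (by omega) (by omega),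
          fun l hl => hreal50 l (.inl (by omega)) (by omega) (by omega)⟩
  rintro s6 ⟨hr6, hreal6, ho6⟩
  refine Ends.straight (by decide) (by decide) ?_
  simp only [Cmd.exec, NExp.eval]
  refine ⟨hE5.congr (fun a ha => ?_) (fun a ha => hreal6 a (by omega)), ?_, ?_, ho6⟩
  · rw [← hr6 a (by omega)]
    exact Function.update_of_ne (by omega) _ _
  · simp [hr6 4 (by omega), hr50 4 (by omega), h4]
  · simp [hr6 5 (by omega), h55]

/-- The state of the search: either nothing has been found yet, or the output cells contain the
truncation belonging to the best score so far. -/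
def BestSoFar (n k d N : ℕ) (lam : ℕ → ℝ) (v : ℕ → ℕ → ℝ) (m : ℕ) (best : ℝ) (out : ℕ → ℝ) :
    Prop :=
  (best = 0 ∨ ∃ t, 0 < score n k d N lam v t ∧ best = score n k d N lam v t ∧
    ∀ l < n, out l = truncation n k (lam d / lam 0) (gridComb d N lam v t) l) ∧
  0 ≤ best ∧ ∀ t < m, score n k d N lam v t ≤ best

theorem ends_mainLoop {s : State} (hs : Env n k d N lam v s) (h4 : s.nat 4 = 0)
    (h5 : s.nat 5 = 0) (hb : s.real n = 0) :
    Ends O mainLoop s (((2 * N + 1) ^ d + 1) * (n * (n * 150 + 400) +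
      d * (n * 100 + (2 * N + 1) ^ d * 50 + 300) + 810) + 10) fun s' =>
      BestSoFar n k d N lam v ((2 * N + 1) ^ d) (s'.real n) s'.real := by
  classical
  set D := (2 * N + 1) ^ d with hD
  have hD0 : 0 < D := by positivity
  -- The passes are those for `t = 0, …, D`. Before pass `i` register 5 stems from pass `i - 1`;
  -- truncated subtraction makes the formula agree with the initial value `0` at `i = 0`.
  refine (Ends.loop (T := n * (n * 150 + 400) + d * (n * 100 + D * 50 + 300) + 800) (m := D + 1)
    (I := fun i s' => Env n k d N lam v s' ∧ s'.nat 4 = i ∧ s'.nat 5 = (i - 1) / D ∧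
      BestSoFar n k d N lam v i (s'.real n) s'.real) ?_ ?_ ?_).mono ?_ ?_
  · rintro i hi s1 ⟨hE1, h41, h51, hb1, hb2, hb3⟩
    refine ⟨?_, (ends_body hE1 h41).mono ?_ ?_⟩
    · simp only [Cond.Holds, NExp.eval, h51]
      rw [Nat.div_eq_of_lt (by omega)]
      exact zero_lt_one
    · gcongr
      omega
    · rintro s2 ⟨hE2, h42, h52, hout⟩
      refine ⟨hE2, h42, by rw [h52]; rfl, ?_⟩
      split_ifs at hout with hc
      · refine ⟨.inr ⟨i, hb2.trans_lt hc, hout.1, hout.2⟩, ?_, fun t ht => ?_⟩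
        · rw [hout.1]; exact (hb2.trans_lt hc).le
        · rw [hout.1]
          rcases Nat.lt_succ_iff_lt_or_eq.mp ht with h | rfl
          · exact (hb3 t h).trans hc.le
          · exact le_rfl
      · rw [hout.1]
        refine ⟨hb1.imp id ?_, hb2, fun t ht => ?_⟩
        · rintro ⟨t, ht, ht', ho⟩
          exact ⟨t, ht, ht', fun l hl => by rw [hout.2 l hl, ho l hl]⟩
        · rcases Nat.lt_succ_iff_lt_or_eq.mp ht with h | rfl
          · exact hb3 t h
          · exact not_lt.mp hc
  · rintro s' ⟨-, -, h5', -⟩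
    simp only [Cond.Holds, NExp.eval, h5', Nat.add_sub_cancel, Nat.div_self hD0]
    exact lt_irrefl _
  · exact ⟨hs, h4, by simp [h5], .inl hb, hb.ge, by simp⟩
  · refine Nat.add_le_add (Nat.mul_le_mul_left _ ?_) (by decide)
    simp only [Cond.cost, NExp.cost]
    omega
  · rintro s' ⟨-, -, -, h1, h2, h3⟩
    exact ⟨h1, h2, fun t ht => h3 t (by omega)⟩

/-- The hypothesis `hN` says that the loop test succeeds exactly for the values below `N`, which is
all the loop needs; that such an `N` exists depends on `λ_{d+1} > 0` and is settled in the main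
theorem. -/
theorem ends_gridLoop {s : State} (hs : Env n k d 0 lam v s)
    (hN : ∀ i : ℕ, (i : ℝ) * lam d < 2 * d * lam 0 ↔ i < N) :
    Ends O gridLoop s (N * 60 + 60) fun s' =>
      Env n k d N lam v s' ∧ (∀ a, a ≠ 3 → s'.nat a = s.nat a) ∧ s'.real = s.real := by
  have hcond : ∀ i s', s'.nat 3 = i → (∀ a, a ≠ 3 → s'.nat a = s.nat a) → s'.real = s.real →
      ((Cond.realLt (.mul (.ofNat (reg 3)) (.cell (lamAddr (reg 2))))
        (.mul (.mul (.const 2) (.ofNat (reg 2))) (.cell (lamAddr (.const 0))))).Holds s' ↔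
        i < N) := by
    intro i s' h3 hr hreal
    rw [← hN i]
    have e0 : s'.nat 0 = n := by rw [hr 0 (by omega), hs.hn]
    have e2 : s'.nat 2 = d := by rw [hr 2 (by omega), hs.hd]
    have el : s.real (n + n + 10) = lam 0 := hs.hlam 0 (by omega)
    simp only [Cond.Holds, RExp.eval, NExp.eval, h3, e0, e2, hreal, hs.hlam d le_rfl, add_zero, el]
    norm_num
  refine (Ends.loop (T := 20) (m := N) (I := fun i s' => s'.nat 3 = i ∧
      (∀ a, a ≠ 3 → s'.nat a = s.nat a) ∧ s'.real = s.real) ?_ ?_ ?_).mono ?_ ?_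
  · rintro i hi s' ⟨h3, hr, hreal⟩
    refine ⟨(hcond i s' h3 hr hreal).mpr hi, Ends.straight (by decide) (by decide) ?_⟩
    simp only [Cmd.exec, NExp.eval]
    exact ⟨by simp [h3], fun a ha => by simp [ha, hr a ha], hreal⟩
  · rintro s' ⟨h3, hr, hreal⟩ hc
    exact lt_irrefl _ ((hcond N s' h3 hr hreal).mp hc)
  · exact ⟨hs.hN, fun _ _ => rfl, rfl⟩
  · simp only [Cond.cost, NExp.cost, RExp.cost]; omega
  · rintro s' ⟨h3, hr, hreal⟩
    refine ⟨⟨?_, ?_, ?_, h3, ?_, ?_⟩, hr, hreal⟩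
    · rw [hr 0 (by omega), hs.hn]
    · rw [hr 1 (by omega), hs.hk]
    · rw [hr 2 (by omega), hs.hd]
    · rw [hreal]; exact hs.hlam
    · rw [hreal]; exact hs.hvec

theorem ends_uniformLoop {s : State} (h0 : s.nat 0 = n) (h1 : s.nat 1 = k) (h8 : s.nat 8 = 0) :
    Ends O uniformLoop s (n * 60 + 60) fun s' =>
      ∀ l < n, s'.real l = if l < k then 1 / √k else 0 := by
  refine (Ends.loop (T := 50) (m := n) (I := fun i s' => s'.nat 8 = i ∧
      (∀ a, a ≠ 8 → s'.nat a = s.nat a) ∧ ∀ l < i, s'.real l = if l < k then 1 / √k else 0)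
      ?_ ?_ ?_).mono ?_ ?_
  · rintro i hi s' ⟨e8, hr, ho⟩
    have e0 : s'.nat 0 = n := by rw [hr 0 (by omega), h0]
    have e1 : s'.nat 1 = k := by rw [hr 1 (by omega), h1]
    refine ⟨by simp [Cond.Holds, NExp.eval, e8, e0, hi],
      Ends.straight (by decide) (by decide) ?_⟩
    have key : Cmd.exec uniformStep s' = ⟨Function.update s'.nat 8 (i + 1),
        Function.update s'.real i (if i < k then 1 / √k else 0)⟩ := by
      simp only [uniformStep, Cmd.exec, NExp.eval, RExp.eval, Cond.Holds, e8, e1]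
      split_ifs <;> simp [e8]
    rw [key]
    refine ⟨by simp, fun a ha => by simp [ha, hr a ha], fun l hl => ?_⟩
    rcases Nat.lt_succ_iff_lt_or_eq.mp hl with h | rfl
    · simp only [Function.update_apply]
      rw [if_neg (by omega), ho l h]
    · simp
  · rintro s' ⟨e8, hr, -⟩
    have e0 : s'.nat 0 = n := by rw [hr 0 (by omega), h0]
    simp [Cond.Holds, NExp.eval, e8, e0]
  · exact ⟨h8, fun _ _ => rfl, by simp⟩
  · simp only [Cond.cost, NExp.cost]; omega
  · rintro s' ⟨-, -, h⟩
    exact h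

theorem readMatrix_initState (k d : ℕ) (A : Matrix (Fin n) (Fin n) ℝ) :
    readMatrix (initState k d A).real 0 n = A := by
  ext i j
  have hn : 0 < n := i.pos
  have hlt : 0 + (i : ℕ) * n + j < n * n := by nlinarith [i.2, j.2]
  refine (dif_pos hlt).trans ?_
  congr 2
  · rw [zero_add, mul_comm, Nat.mul_add_div hn, Nat.div_eq_of_lt j.2, add_zero]
  · rw [zero_add, mul_comm, Nat.mul_add_mod, Nat.mod_eq_of_lt j.2]

/-- The dimension occurs in the type of the matrix, so the values of the operands enter through
equations that can be substituted, which avoids rewriting inside dependent types. -/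
theorem ends_eig {src m r dst : NExp} {s : State} {p q b : ℕ} {M : Matrix (Fin p) (Fin p) ℝ}
    (hm : m.eval s = p) (hM : readMatrix s.real (src.eval s) p = M)
    (hr : min (r.eval s) p = q) (hdst : dst.eval s = b) :
    Ends O (.eig src m r dst) s
      (src.cost + m.cost + r.cost + dst.cost + q * p ^ 2 + 1) fun s' =>
      s' = ⟨s.nat, eigWrite O s.real p M q b⟩ := by
  subst hm hM hr hdst
  exact ⟨_, _, .eig _ _ _ _ _, le_rfl, rfl⟩

theorem ends_program_of_eq_zero (A : Matrix (Fin n) (Fin n) ℝ) :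
    Ends O program (initState k 0 A) (n * 60 + 70) fun s' =>
      ∀ l < n, s'.real l = if l < k then 1 / √k else 0 := by
  refine Ends.mono (T := 4 + (n * 60 + 60)) ?_ (by omega) (fun _ h => h)
  refine Ends.ite (fun _ => ends_uniformLoop rfl rfl rfl) (fun h => absurd ?_ h)
  simp [Cond.Holds, NExp.eval, initState]

theorem ends_program_of_pos (A : Matrix (Fin n) (Fin n) ℝ) (hd : 0 < d) (hdn : d + 1 ≤ n)
    (hN : ∀ i : ℕ, (i : ℝ) * O.val n A d < 2 * d * O.val n A 0 ↔ i < N) :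
    Ends O program (initState k d A) ((d + 1) * n ^ 2 + N * 60 +
      ((2 * N + 1) ^ d + 1) * (n * (n * 150 + 400) + d * (n * 100 + (2 * N + 1) ^ d * 50 + 300)
        + 810) + 200) fun s' =>
      BestSoFar n k d N (O.val n A) (O.vec n A) ((2 * N + 1) ^ d) (s'.real n) s'.real := by
  refine Ends.mono (T := 4 + (((d + 1) * n ^ 2 + 50) + ((N * 60 + 60) + (20 +
    (((2 * N + 1) ^ d + 1) * (n * (n * 150 + 400) + d * (n * 100 + (2 * N + 1) ^ d * 50 + 300)
        + 810) + 10))))) ?_ (by omega) (fun _ h => h)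
  refine Ends.ite (fun h => ?_) (fun _ => ?_)
  · simp [Cond.Holds, NExp.eval, initState] at h
    omega
  refine Ends.seq (Q := fun s' => Env n k d 0 (O.val n A) (O.vec n A) s' ∧
    s'.nat = (initState k d A).nat) ?_ ?_
  · refine (ends_eig (p := n) (q := d + 1) (b := n + n + 10) (M := A) rfl
      (readMatrix_initState k d A) (by exact min_eq_left hdn) rfl).mono ?_ ?_
    · simp only [NExp.cost]
      omega
    · rintro _ rfl
      refine ⟨⟨rfl, rfl, rfl, rfl, fun j hj => ?_, fun j hj l hl => ?_⟩, rfl⟩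
      · simp only [eigWrite]
        rw [if_neg (by omega), if_pos (by omega)]
        congr 1
        omega
      · have h1 : j * n + l < (d + 1) * n := by nlinarith
        simp only [eigWrite]
        rw [if_neg (by omega), if_neg (by omega), if_pos (by omega)]
        have h2 : n + n + 10 + (d + 1) + j * n + l - (n + n + 10) - (d + 1) = n * j + l := by
          rw [mul_comm n j]; omega
        rw [h2, Nat.mul_add_div (by omega), Nat.div_eq_of_lt hl, add_zero, Nat.mul_add_mod,
          Nat.mod_eq_of_lt hl]
  rintro s1 ⟨hE1, hnat1⟩
  refine (ends_gridLoop hE1 hN).seq ?_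
  rintro s2 ⟨hE2, hr2, hreal2⟩
  refine Ends.seq (Q := fun s3 => s3.nat = s2.nat ∧ s3.real n = 0 ∧
    ∀ a, a ≠ n → s3.real a = s2.real a) (Ends.straight (by decide) (by decide) ?_) ?_
  · simp only [Cmd.exec, NExp.eval, RExp.eval, hE2.hn, add_zero, Rat.cast_zero]
    exact ⟨trivial, by simp, fun a ha => by simp [ha]⟩
  rintro s3 ⟨hnat3, hb3, hreal3⟩
  have e : ∀ a, a ≠ 3 → s3.nat a = (initState k d A).nat a := fun a ha => by
    rw [hnat3, hr2 a ha, hnat1]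
  exact ends_mainLoop (hE2.congr (fun a _ => by rw [hnat3]) (fun a ha => hreal3 a (by omega)))
    (e 4 (by omega)) (e 5 (by omega)) hb3

/-! ### The largest entries of a vector -/

theorem Precedes.irrefl (w : ℕ → ℝ) (i : ℕ) : ¬ Precedes w i i := by
  simp [Precedes]

theorem Precedes.le {w : ℕ → ℝ} {i l : ℕ} (h : Precedes w i l) : w l * w l ≤ w i * w i := by
  unfold Precedes at h
  split_ifs at h
  · exact not_lt.mp h
  · exact h.le

theorem Precedes.trans {w : ℕ → ℝ} {i j l : ℕ} (h : Precedes w i j) (h' : Precedes w j l) :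
    Precedes w i l := by
  have h1 := h.le
  have h2 := h'.le
  unfold Precedes at *
  split_ifs at * <;> first | omega | (simp only [not_lt] at *; linarith)

theorem Precedes.total (w : ℕ → ℝ) {i l : ℕ} (h : i ≠ l) : Precedes w i l ∨ Precedes w l i := by
  unfold Precedes
  split_ifs
  · omega
  · exact (em _).symm
  · exact em _
  · omega

theorem rank_lt_rank {w : ℕ → ℝ} {i l : ℕ} (hi : i < n) (h : Precedes w i l) :
    rank n w i < rank n w l := by
  classical
  refine Finset.card_lt_card (Finset.ssubset_iff_of_subset (fun a ha => ?_) |>.mpr ⟨i, ?_, ?_⟩)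
  · rw [Finset.mem_filter] at ha ⊢
    exact ⟨ha.1, ha.2.trans h⟩
  · exact Finset.mem_filter.mpr ⟨Finset.mem_range.mpr hi, h⟩
  · exact fun hi' => Precedes.irrefl w i (Finset.mem_filter.mp hi').2

/-- Breaking ties by the index makes `Precedes` a strict total order. Ranks are therefore distinct,
and exactly `k` of them lie below `k`, even when entries have equal squares. -/
theorem rank_injOn (w : ℕ → ℝ) : Set.InjOn (rank n w) (Finset.range n : Finset ℕ) := by
  intro a ha b hb hab
  by_contra hne
  rcases Precedes.total w hne with h | h
  · exact (rank_lt_rank (Finset.mem_range.mp ha) h).ne hab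
  · exact (rank_lt_rank (Finset.mem_range.mp hb) h).ne' hab

theorem rank_lt {w : ℕ → ℝ} {l : ℕ} (hl : l < n) : rank n w l < n := by
  classical
  conv_rhs => rw [← Finset.card_range n]
  refine Finset.card_lt_card ((Finset.ssubset_iff_of_subset (Finset.filter_subset _ _)).mpr
    ⟨l, Finset.mem_range.mpr hl, fun h => ?_⟩)
  exact Precedes.irrefl w l (Finset.mem_filter.mp h).2

/-- The indices of the `k` largest of the first `n` entries of `w`. -/
def topSet (n k : ℕ) (w : ℕ → ℝ) : Finset ℕ := (Finset.range n).filter (rank n w · < k)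

theorem card_topSet (hk : k ≤ n) (w : ℕ → ℝ) : (topSet n k w).card = k := by
  have himg : (Finset.range n).image (rank n w) = Finset.range n := by
    refine Finset.eq_of_subset_of_card_le (fun a ha => ?_) ?_
    · obtain ⟨l, hl, rfl⟩ := Finset.mem_image.mp ha
      exact Finset.mem_range.mpr (rank_lt (Finset.mem_range.mp hl))
    · rw [Finset.card_image_of_injOn (rank_injOn w)]
  have h : (topSet n k w).image (rank n w) = Finset.range k := by
    ext a
    simp only [topSet, Finset.mem_image, Finset.mem_filter, Finset.mem_range]
    constructor
    · rintro ⟨l, ⟨-, h⟩, rfl⟩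
      exact h
    · intro ha
      have : a ∈ (Finset.range n).image (rank n w) := by
        rw [himg]; exact Finset.mem_range.mpr (ha.trans_le hk)
      obtain ⟨l, hl, rfl⟩ := Finset.mem_image.mp this
      exact ⟨l, ⟨Finset.mem_range.mp hl, ha⟩, rfl⟩
  have hinj : Set.InjOn (rank n w) (topSet n k w) :=
    (rank_injOn w).mono (Finset.coe_subset.mpr (Finset.filter_subset (rank n w · < k) _))
  rw [← Finset.card_image_of_injOn hinj, h, Finset.card_range]

theorem topSum_eq_sum (w : ℕ → ℝ) : topSum n k w n = ∑ l ∈ topSet n k w, w l * w l :=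
  (Finset.sum_filter (rank n w · < k) _).symm

theorem topSum_nonneg (w : ℕ → ℝ) : 0 ≤ topSum n k w n := by
  rw [topSum_eq_sum]
  exact Finset.sum_nonneg fun l _ => mul_self_nonneg _

/-- A threshold separating the `k` largest entries from the others. -/
theorem exists_threshold (hk0 : 0 < k) (hk : k ≤ n) (w : ℕ → ℝ) : ∃ θ : ℝ, 0 ≤ θ ∧
    (∀ a ∈ topSet n k w, θ ≤ w a * w a) ∧
    ∀ b ∈ Finset.range n, b ∉ topSet n k w → w b * w b ≤ θ := by
  have hne : (topSet n k w).Nonempty := by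
    rw [← Finset.card_pos, card_topSet hk]; exact hk0
  obtain ⟨c, hc, hmin⟩ := Finset.exists_min_image _ (fun a => w a * w a) hne
  refine ⟨w c * w c, mul_self_nonneg _, hmin, fun b hb hbt => ?_⟩
  simp only [topSet, Finset.mem_filter, not_and, not_lt] at hbt hc
  have hlt := hc.2.trans_le (hbt hb)
  have hcb : c ≠ b := by rintro rfl; exact lt_irrefl _ hlt
  rcases Precedes.total w hcb with h | h
  · exact h.le
  · exact absurd (rank_lt_rank (Finset.mem_range.mp hb) h) hlt.not_gt

/-- Exchange argument: outside their intersection, entries of `T` lie below the threshold and those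
of the top set above it, and `T` has no more of them. -/
theorem sum_le_topSum (hk0 : 0 < k) (hk : k ≤ n) (w : ℕ → ℝ) {T : Finset ℕ}
    (hT : T ⊆ Finset.range n) (hTk : T.card ≤ k) :
    ∑ l ∈ T, w l * w l ≤ topSum n k w n := by
  obtain ⟨θ, h0, h1, h2⟩ := exists_threshold hk0 hk w
  set S := topSet n k w with hS
  have hcard : (T \ S).card ≤ (S \ T).card := by
    have e1 := Finset.card_sdiff_add_card_inter T S
    have e2 := Finset.card_sdiff_add_card_inter S T
    rw [Finset.inter_comm] at e2
    have e3 : S.card = k := card_topSet hk w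
    omega
  have e1 : ∑ l ∈ T \ S, w l * w l ≤ (T \ S).card • θ :=
    Finset.sum_le_card_nsmul _ _ _ fun b hb =>
      h2 b (hT (Finset.mem_sdiff.mp hb).1) (Finset.mem_sdiff.mp hb).2
  have e2 : (S \ T).card • θ ≤ ∑ l ∈ S \ T, w l * w l :=
    Finset.card_nsmul_le_sum _ _ _ fun a ha => h1 a (Finset.mem_sdiff.mp ha).1
  have e3 : (T \ S).card • θ ≤ (S \ T).card • θ := nsmul_le_nsmul_left h0 hcard
  rw [topSum_eq_sum, ← Finset.sum_inter_add_sum_sdiff T S, ← hS,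
    ← Finset.sum_inter_add_sum_sdiff S T, Finset.inter_comm S T]
  linarith

/-- The mean of the `k` largest squares is at least the mean of all of them. -/
theorem mul_sum_le_topSum (hk0 : 0 < k) (hk : k ≤ n) (w : ℕ → ℝ) :
    (k : ℝ) * ∑ l ∈ Finset.range n, w l * w l ≤ n * topSum n k w n := by
  obtain ⟨θ, h0, h1, h2⟩ := exists_threshold hk0 hk w
  set S := topSet n k w with hS
  have hsub : S ⊆ Finset.range n := Finset.filter_subset _ _
  have hc : S.card = k := card_topSet hk w
  have e1 : ∑ l ∈ Finset.range n \ S, w l * w l ≤ (Finset.range n \ S).card • θ :=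
    Finset.sum_le_card_nsmul _ _ _ fun b hb =>
      h2 b (Finset.mem_sdiff.mp hb).1 (Finset.mem_sdiff.mp hb).2
  have e2 : S.card • θ ≤ ∑ l ∈ S, w l * w l := Finset.card_nsmul_le_sum _ _ _ h1
  rw [Finset.card_sdiff_of_subset hsub, Finset.card_range, hc, nsmul_eq_mul,
    Nat.cast_sub hk] at e1
  rw [hc, nsmul_eq_mul] at e2
  rw [topSum_eq_sum, ← hS, ← Finset.sum_sdiff hsub]
  have hkn : (k : ℝ) ≤ n := by exact_mod_cast hk
  have hk0' : (0 : ℝ) < k := by exact_mod_cast hk0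
  -- Both `k` times the sum outside the top set and `n - k` times the sum inside are compared with
  -- `k (n - k) θ`.
  nlinarith [mul_le_mul_of_nonneg_left e1 hk0'.le,
    mul_le_mul_of_nonneg_left e2 (sub_nonneg.mpr hkn)]

/-! ### Quality of the truncations -/

/-- The quadratic form of the truncated spectral decomposition. -/
def lowRank (n d : ℕ) (lam : ℕ → ℝ) (v : ℕ → ℕ → ℝ) (x : ℕ → ℝ) : ℝ :=
  ∑ j ∈ Finset.range d, lam j * (∑ l ∈ Finset.range n, v j l * x l) ^ 2

theorem sum_gridComb_mul (t : ℕ) (x : ℕ → ℝ) :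
    ∑ l ∈ Finset.range n, gridComb d N lam v t l * x l =
      ∑ j ∈ Finset.range d, gridCoord N t j * (√(lam j) * ∑ l ∈ Finset.range n, v j l * x l) := by
  simp only [gridComb, Finset.sum_mul, Finset.mul_sum]
  rw [Finset.sum_comm]
  exact Finset.sum_congr rfl fun _ _ => Finset.sum_congr rfl fun _ _ => by ring

theorem lowRank_eq_sum_sq (hlam : ∀ j < d, 0 ≤ lam j) (x : ℕ → ℝ) :
    lowRank n d lam v x =
      ∑ j ∈ Finset.range d, (√(lam j) * ∑ l ∈ Finset.range n, v j l * x l) ^ 2 := by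
  refine Finset.sum_congr rfl fun j hj => ?_
  rw [mul_pow, Real.sq_sqrt (hlam j (Finset.mem_range.mp hj))]

theorem lowRank_nonneg (hlam : ∀ j < d, 0 ≤ lam j) (y : ℕ → ℝ) : 0 ≤ lowRank n d lam v y :=
  Finset.sum_nonneg fun j hj => mul_nonneg (hlam j (Finset.mem_range.mp hj)) (sq_nonneg _)

theorem gridNormSq_nonneg (t : ℕ) : 0 ≤ gridNormSq d N t :=
  Finset.sum_nonneg fun _ _ => mul_self_nonneg _

theorem sq_sum_gridComb_mul_le (hlam : ∀ j < d, 0 ≤ lam j) (t : ℕ) (x : ℕ → ℝ) :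
    (∑ l ∈ Finset.range n, gridComb d N lam v t l * x l) ^ 2 ≤
      gridNormSq d N t * lowRank n d lam v x := by
  rw [sum_gridComb_mul, lowRank_eq_sum_sq hlam, gridNormSq]
  simp only [← sq]
  exact Finset.sum_mul_sq_le_sq_mul_sq _ _ _

theorem filler_mul_self {r : ℝ} (hr : 0 ≤ r) (w : ℕ → ℝ) :
    filler n k r w * filler n k r w = topSum n k w n * r / (2 * n) :=
  Real.mul_self_sqrt (by have := topSum_nonneg (n := n) (k := k) w; positivity)

theorem topZeros_le (w : ℕ → ℝ) : topZeros n k w n ≤ n := by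
  classical
  refine (Finset.sum_le_card_nsmul _ _ 1 fun l _ => ?_).trans (by simp)
  split_ifs <;> simp

theorem filledNorm_mul_self {r : ℝ} (w : ℕ → ℝ) :
    filledNorm n k r w * filledNorm n k r w =
      topSum n k w n + topZeros n k w n * (filler n k r w * filler n k r w) :=
  Real.mul_self_sqrt (by
    have := topSum_nonneg (n := n) (k := k) w
    have := mul_self_nonneg (filler n k r w)
    positivity)

section Truncation

variable {r : ℝ} {w : ℕ → ℝ}

theorem filledNorm_pos (hW : 0 < topSum n k w n) : 0 < filledNorm n k r w :=
  Real.sqrt_pos.mpr (by have := mul_self_nonneg (filler n k r w); positivity)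

theorem sum_truncation_sq (hW : 0 < topSum n k w n) :
    ∑ l ∈ Finset.range n, truncation n k r w l ^ 2 = 1 := by
  classical
  have hpos := filledNorm_pos (r := r) hW
  have hpt : ∀ l, truncation n k r w l ^ 2 =
      ((if rank n w l < k then w l * w l else 0) +
        ((if rank n w l < k then if 0 < w l * w l then 0 else 1 else 0 : ℕ) : ℝ) *
          (filler n k r w * filler n k r w)) / (filledNorm n k r w * filledNorm n k r w) := by
    intro l
    unfold truncation
    split_ifs with h1 h2
    · rw [div_pow]; simp; ring
    · have h3 : w l * w l = 0 := le_antisymm (not_lt.mp h2) (mul_self_nonneg _)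
      rw [div_pow, h3]; simp; ring
    · simp
  rw [Finset.sum_congr rfl fun l _ => hpt l, ← Finset.sum_div, Finset.sum_add_distrib,
    ← Finset.sum_mul, ← Nat.cast_sum]
  rw [show (∑ l ∈ Finset.range n, if rank n w l < k then w l * w l else 0) = topSum n k w n
    from rfl, show (∑ l ∈ Finset.range n, if rank n w l < k then
      if 0 < w l * w l then 0 else 1 else 0) = topZeros n k w n from rfl,
    ← filledNorm_mul_self]
  exact div_self (by positivity)

theorem truncation_ne_zero_iff (hn : 0 < n) (hr : 0 < r) (hW : 0 < topSum n k w n) (l : ℕ) :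
    truncation n k r w l ≠ 0 ↔ rank n w l < k := by
  classical
  have hpos := filledNorm_pos (r := r) hW
  have hfill : filler n k r w ≠ 0 := by
    have : (0 : ℝ) < n := by exact_mod_cast hn
    exact (Real.sqrt_pos.mpr (by positivity)).ne'
  unfold truncation
  split_ifs with h1 h2
  · have : w l ≠ 0 := fun h => by simp [h] at h2
    simp [this, hpos.ne', h1]
  · simp [hfill, hpos.ne', h1]
  · simp [h1]

/-- Filler entries sit where `w` vanishes, so they do not contribute to the inner product; they only
enlarge the norm. -/
theorem sum_mul_truncation :
    ∑ l ∈ Finset.range n, w l * truncation n k r w l = topSum n k w n / filledNorm n k r w := by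
  classical
  rw [topSum, Finset.sum_div]
  refine Finset.sum_congr rfl fun l _ => ?_
  unfold truncation
  split_ifs with h1 h2
  · ring
  · have h3 : w l = 0 := by
      by_contra h
      exact h2 (mul_self_pos.mpr h)
    simp [h3]
  · simp

/-- There are at most `n` fillers, each of square `W r / (2n)` with `W` the top sum, so they add at
most `W r / 2`. -/
theorem filledNorm_mul_self_le (hr : 0 ≤ r) :
    filledNorm n k r w * filledNorm n k r w ≤ topSum n k w n * (1 + r / 2) := by
  have hW := topSum_nonneg (n := n) (k := k) w
  rw [filledNorm_mul_self, filler_mul_self hr]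
  rcases Nat.eq_zero_or_pos n with rfl | hn
  · simp [topSum]
  have hn' : (0 : ℝ) < n := by exact_mod_cast hn
  have h1 : (topZeros n k w n : ℝ) ≤ n := by exact_mod_cast topZeros_le w
  have h2 : (topZeros n k w n : ℝ) * (topSum n k w n * r / (2 * n)) ≤
      n * (topSum n k w n * r / (2 * n)) := mul_le_mul_of_nonneg_right h1 (by positivity)
  have h3 : (n : ℝ) * (topSum n k w n * r / (2 * n)) = topSum n k w n * (r / 2) := by
    field_simp
  linarith

end Truncation

/-- With `F` the form at the truncation and `Q = |g|²`, Cauchy–Schwarz in `ℝ^d` gives `W² ≤ Q F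
‖·‖²`, where the squared norm of the filled vector is at most `W (1 + r / 2)`. Hence the score `W /
Q` is at most `F (1 + r / 2)`, and `(1 - r / 2)(1 + r / 2) ≤ 1`. -/
theorem score_le_lowRank_truncation (hlam : ∀ j < d, 0 ≤ lam j) {r : ℝ}
    (hr : 0 ≤ r) {t : ℕ} (ht : 0 < score n k d N lam v t) :
    (1 - r / 2) * score n k d N lam v t ≤
      lowRank n d lam v (truncation n k r (gridComb d N lam v t)) := by
  set w := gridComb d N lam v t with hw
  have hQ : 0 < gridNormSq d N t := by
    refine (gridNormSq_nonneg t).lt_of_ne fun h => ?_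
    rw [score, ← h, div_zero] at ht
    exact lt_irrefl _ ht
  have hW : 0 < topSum n k w n := by
    refine (topSum_nonneg w).lt_of_ne fun h => ?_
    rw [score, ← hw, ← h, zero_div] at ht
    exact lt_irrefl _ ht
  have hpos := filledNorm_pos (r := r) hW
  have h1 := sq_sum_gridComb_mul_le (N := N) (n := n) (v := v) hlam t (truncation n k r w)
  rw [← hw, sum_mul_truncation, div_pow, sq (filledNorm n k r w)] at h1
  have h2 := filledNorm_mul_self_le (n := n) (k := k) (w := w) hr
  rw [div_le_iff₀ (by positivity)] at h1
  set F := lowRank n d lam v (truncation n k r w) with hF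
  have hF0 : 0 ≤ F := lowRank_nonneg hlam _
  set W := topSum n k w n
  set Q := gridNormSq d N t
  have h3 : W ≤ Q * F * (1 + r / 2) := by
    have : W * W ≤ W * (Q * F * (1 + r / 2)) := by
      nlinarith [mul_le_mul_of_nonneg_left h2 (mul_nonneg hQ.le hF0)]
    exact le_of_mul_le_mul_left this hW
  have h4 : score n k d N lam v t ≤ F * (1 + r / 2) := by
    rw [score, ← hw, div_le_iff₀ hQ]
    linarith
  rcases le_total 0 (1 - r / 2) with h | h
  · nlinarith [mul_le_mul_of_nonneg_left h4 h, mul_nonneg hF0 (sq_nonneg r)]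
  · nlinarith

/-! ### The grid -/

theorem exists_gridCoord_eq {g : ℕ → ℤ} (hg : ∀ j < d, -(N : ℤ) ≤ g j ∧ g j ≤ N) :
    ∃ t < (2 * N + 1) ^ d, ∀ j < d, gridCoord N t j = g j := by
  let f : Fin d → Fin (2 * N + 1) := fun j =>
    ⟨(g j + N).toNat, by have := hg j j.2; omega⟩
  refine ⟨finFunctionFinEquiv f, (finFunctionFinEquiv f).2, fun j hj => ?_⟩
  have h := finFunctionFinEquiv_symm_apply_val (finFunctionFinEquiv f) ⟨j, hj⟩
  rw [Equiv.symm_apply_apply] at h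
  have h2 : ((f ⟨j, hj⟩ : ℕ) : ℤ) = g j + N := by
    have := hg j hj
    simp only [f]
    omega
  have h3 : ((f ⟨j, hj⟩ : ℕ) : ℝ) = g j + N := by exact_mod_cast h2
  rw [gridCoord, ← h, h3]
  ring

/-- The left side is `|g|²` times the squared distance from `h` to the line spanned by `g`, so any
point `c g` of the line gives an upper bound; the difference of the two sides is the square of `⟨g,
h⟩ - c |g|²`. -/
theorem sum_sq_mul_sub_sq_le {ι : Type*} (s : Finset ι) (g h : ι → ℝ) (c : ℝ) :
    (∑ i ∈ s, g i ^ 2) * (∑ i ∈ s, h i ^ 2) - (∑ i ∈ s, g i * h i) ^ 2 ≤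
      (∑ i ∈ s, g i ^ 2) * ∑ i ∈ s, (h i - c * g i) ^ 2 := by
  have e : ∑ i ∈ s, (h i - c * g i) ^ 2 =
      ∑ i ∈ s, h i ^ 2 - 2 * c * ∑ i ∈ s, g i * h i + c ^ 2 * ∑ i ∈ s, g i ^ 2 := by
    rw [Finset.mul_sum, Finset.mul_sum, ← Finset.sum_sub_distrib, ← Finset.sum_add_distrib]
    exact Finset.sum_congr rfl fun _ _ => by ring
  rw [e]
  nlinarith [sq_nonneg (∑ i ∈ s, g i * h i - c * ∑ i ∈ s, g i ^ 2)]

/-- Every sparse unit vector is almost beaten by some grid vector. -/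
theorem exists_lowRank_le_score (hk0 : 0 < k) (hk : k ≤ n) (hN : 0 < N)
    (hlam : ∀ j < d, 0 ≤ lam j) {y : ℕ → ℝ} (hy : ∑ l ∈ Finset.range n, y l ^ 2 = 1)
    (hyk : ((Finset.range n).filter (y · ≠ 0)).card ≤ k) :
    ∃ t < (2 * N + 1) ^ d,
      (1 - d / N ^ 2) * lowRank n d lam v y ≤ score n k d N lam v t := by
  set h : ℕ → ℝ := fun j => √(lam j) * ∑ l ∈ Finset.range n, v j l * y l with hh
  set H := lowRank n d lam v y with hH
  have hHsum : H = ∑ j ∈ Finset.range d, h j ^ 2 := lowRank_eq_sum_sq hlam y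
  have hH0 : 0 ≤ H := lowRank_nonneg hlam y
  have hN' : (0 : ℝ) < N := by exact_mod_cast hN
  have hle : ∀ j < d, |h j| ≤ √H := fun j hj => by
    refine Real.abs_le_sqrt ?_
    rw [hHsum]
    exact Finset.single_le_sum (f := fun j => h j ^ 2) (fun _ _ => sq_nonneg _)
      (Finset.mem_range.mpr hj)
  have hu : ∀ j < d, |N * (h j / √H)| ≤ N := fun j hj => by
    rw [abs_mul, abs_div, abs_of_pos hN', abs_of_nonneg (Real.sqrt_nonneg H)]
    exact mul_le_of_le_one_right hN'.le (div_le_one_of_le₀ (hle j hj) (Real.sqrt_nonneg _))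
  -- The direction of `h` is scaled so that its coordinates fill at most `[-N, N]` and is then
  -- rounded down; each coordinate of `h` is thereby recovered up to `√H / N`.
  obtain ⟨t, ht, hgt⟩ := exists_gridCoord_eq (d := d) (N := N)
    (g := fun j => ⌊(N : ℝ) * (h j / √H)⌋) fun j hj => by
      obtain ⟨h1, h2⟩ := abs_le.mp (hu j hj)
      refine ⟨Int.le_floor.mpr (by push_cast; exact h1), ?_⟩
      have h3 : ((⌊(N : ℝ) * (h j / √H)⌋ : ℤ) : ℝ) ≤ ((N : ℤ) : ℝ) :=
        (Int.floor_le _).trans (by push_cast; exact h2)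
      exact_mod_cast h3
  refine ⟨t, ht, ?_⟩
  set g := gridCoord N t with hg
  have hdist : ∑ j ∈ Finset.range d, (h j - √H / N * g j) ^ 2 ≤ d / N ^ 2 * H := by
    have hpt : ∀ j ∈ Finset.range d, (h j - √H / N * g j) ^ 2 ≤ H / N ^ 2 := by
      intro j hj
      have hj' := Finset.mem_range.mp hj
      have h1 := Int.floor_le ((N : ℝ) * (h j / √H))
      have h2 := Int.lt_floor_add_one ((N : ℝ) * (h j / √H))
      rw [← hgt j hj'] at h1 h2
      have h3 : h j - √H / N * g j = √H / N * (N * (h j / √H) - g j) := by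
        -- If `H = 0`, the quotient `h j / √H` is zero by convention, and `h j` vanishes as well.
        rcases eq_or_ne (√H) 0 with h0 | h0
        · have := hle j hj'
          rw [h0] at this
          rw [abs_nonpos_iff.mp this, h0]; simp
        · field_simp
      rw [h3, mul_pow, div_pow, Real.sq_sqrt hH0]
      refine mul_le_of_le_one_right (by positivity) ?_
      rw [sq_le_one_iff_abs_le_one, abs_le]
      constructor <;> linarith
    refine (Finset.sum_le_card_nsmul _ _ _ hpt).trans_eq ?_
    rw [Finset.card_range, nsmul_eq_mul]
    ring
  have hQ : gridNormSq d N t = ∑ j ∈ Finset.range d, g j ^ 2 := by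
    simp only [gridNormSq, sq, hg]
  have hgh : (∑ j ∈ Finset.range d, g j * h j) ^ 2 ≤ topSum n k (gridComb d N lam v t) n := by
    set w := gridComb d N lam v t with hw
    rw [← sum_gridComb_mul t y]
    set T := (Finset.range n).filter (y · ≠ 0) with hT
    have e1 : ∑ l ∈ Finset.range n, w l * y l = ∑ l ∈ T, w l * y l := by
      rw [hT, Finset.sum_filter]
      refine Finset.sum_congr rfl fun l _ => ?_
      split_ifs with h0
      · rfl
      · rw [not_not.mp h0, mul_zero]
    have e2 : ∑ l ∈ T, y l ^ 2 ≤ 1 := by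
      rw [← hy]
      exact Finset.sum_le_sum_of_subset_of_nonneg (Finset.filter_subset _ _)
        fun _ _ _ => sq_nonneg _
    have e3 := sum_le_topSum hk0 hk w (Finset.filter_subset _ _ : T ⊆ Finset.range n) hyk
    simp only [← sq] at e3
    rw [← hw, e1]
    refine (Finset.sum_mul_sq_le_sq_mul_sq _ _ _).trans ?_
    exact (mul_le_of_le_one_right (Finset.sum_nonneg fun _ _ => sq_nonneg _) e2).trans e3
  have hlag := sum_sq_mul_sub_sq_le (Finset.range d) g h (√H / N)
  rw [← hQ, ← hHsum] at hlag
  have hQ0 := gridNormSq_nonneg (d := d) (N := N) t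
  -- If rounding produces the zero vector, the score is `0 / 0 = 0`; the distance bound then reads
  -- `H ≤ d / N² * H`, so the left side is nonpositive.
  rcases hQ0.eq_or_lt with h0 | h0
  · have hg0 : ∀ j ∈ Finset.range d, g j ^ 2 = 0 :=
      (Finset.sum_eq_zero_iff_of_nonneg fun _ _ => sq_nonneg _).mp (hQ ▸ h0.symm)
    have : ∑ j ∈ Finset.range d, (h j - √H / N * g j) ^ 2 = H := by
      rw [hHsum]
      refine Finset.sum_congr rfl fun j hj => ?_
      rw [pow_eq_zero_iff two_ne_zero |>.mp (hg0 j hj), mul_zero, sub_zero]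
    rw [score, ← h0, div_zero]
    linarith
  · rw [score, le_div_iff₀ h0]
    nlinarith [mul_le_mul_of_nonneg_left hdist hQ0]

/-- The leading eigenvector alone gives the fraction `k / n` of the leading eigenvalue. -/
theorem exists_mul_le_score (hk0 : 0 < k) (hk : k ≤ n) (hN : 0 < N) (hd : 0 < d)
    (hlam : 0 ≤ lam 0) (hv : ∑ l ∈ Finset.range n, v 0 l * v 0 l = 1) :
    ∃ t < (2 * N + 1) ^ d, (k : ℝ) / n * lam 0 ≤ score n k d N lam v t := by
  -- The grid vector `(N, 0, …, 0)` makes `w` a multiple of the leading eigenvector.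
  obtain ⟨t, ht, hgt⟩ := exists_gridCoord_eq (d := d) (N := N)
    (g := fun j => if j = 0 then N else 0) fun j hj => by split_ifs <;> omega
  refine ⟨t, ht, ?_⟩
  have hN' : (0 : ℝ) < N := by exact_mod_cast hN
  have hn' : (0 : ℝ) < n := by exact_mod_cast hk0.trans_le hk
  have hQ : gridNormSq d N t = N * N := by
    rw [gridNormSq, Finset.sum_eq_single 0]
    · rw [hgt 0 hd]; simp
    · intro j hj hj0
      rw [hgt j (Finset.mem_range.mp hj)]; simp [hj0]
    · intro h; exact absurd (Finset.mem_range.mpr hd) h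
  have hw : ∀ l, gridComb d N lam v t l = N * √(lam 0) * v 0 l := by
    intro l
    rw [gridComb, Finset.sum_eq_single 0]
    · rw [hgt 0 hd]; simp
    · intro j hj hj0
      rw [hgt j (Finset.mem_range.mp hj)]; simp [hj0]
    · intro h; exact absurd (Finset.mem_range.mpr hd) h
  have h1 := mul_sum_le_topSum hk0 hk (gridComb d N lam v t)
  have h2 : ∑ l ∈ Finset.range n, gridComb d N lam v t l * gridComb d N lam v t l =
      N * N * lam 0 := by
    rw [← mul_one (N * N * lam 0 : ℝ), ← hv, Finset.mul_sum]
    refine Finset.sum_congr rfl fun l _ => ?_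
    rw [hw l]
    calc _ = N * N * (√(lam 0) * √(lam 0)) * (v 0 l * v 0 l) := by ring
      _ = _ := by rw [Real.mul_self_sqrt hlam]
  rw [h2] at h1
  rw [score, hQ, le_div_iff₀ (by positivity), div_mul_eq_mul_div, div_mul_eq_mul_div,
    div_le_iff₀ hn']
  linarith

/-! ### The spectral decomposition -/

theorem Eigensolver.val_antitone (O : Eigensolver) {A : Matrix (Fin n) (Fin n) ℝ}
    (hA : A.PosSemidef) {i j : ℕ} (hij : i ≤ j) (hj : j < n) : O.val n A j ≤ O.val n A i := by
  have h1 := O.val_eq n A hA.isHermitian ⟨i, hij.trans_lt hj⟩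
  have h2 := O.val_eq n A hA.isHermitian ⟨j, hj⟩
  simp only at h1 h2
  rw [h1, h2]
  exact hA.isHermitian.eigenvalues₀_antitone hij

theorem Eigensolver.val_nonneg (O : Eigensolver) {A : Matrix (Fin n) (Fin n) ℝ}
    (hA : A.PosSemidef) {i : ℕ} (hi : i < n) : 0 ≤ O.val n A i := by
  have h1 := O.val_eq n A hA.isHermitian ⟨i, hi⟩
  simp only at h1
  rw [h1]
  have h2 := hA.eigenvalues_nonneg (Fintype.equivOfCardEq
    (Fintype.card_fin (Fintype.card (Fin n))) (Fin.cast (Fintype.card_fin n).symm ⟨i, hi⟩))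
  simpa [Matrix.IsHermitian.eigenvalues, eigval] using h2

theorem Eigensolver.sum_vec_sq (O : Eigensolver) {A : Matrix (Fin n) (Fin n) ℝ}
    (hA : A.PosSemidef) {i : ℕ} (hi : i < n) :
    ∑ l ∈ Finset.range n, O.vec n A i l * O.vec n A i l = 1 := by
  have h := O.orthonormal n A hA.isHermitian ⟨i, hi⟩ ⟨i, hi⟩
  rw [if_pos rfl] at h
  rw [← h, Finset.sum_range]

/-- The eigenvectors as the rows of a matrix. -/
def Eigensolver.basisMatrix (O : Eigensolver) (A : Matrix (Fin n) (Fin n) ℝ) :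
    Matrix (Fin n) (Fin n) ℝ := Matrix.of fun i l => O.vec n A i l

theorem Eigensolver.basisMatrix_mul_transpose (O : Eigensolver) {A : Matrix (Fin n) (Fin n) ℝ}
    (hA : A.PosSemidef) : O.basisMatrix A * (O.basisMatrix A)ᵀ = 1 := by
  ext i j
  rw [Matrix.mul_apply, Matrix.one_apply]
  exact O.orthonormal n A hA.isHermitian i j

theorem Eigensolver.basisMatrix_mulVec (O : Eigensolver) (A : Matrix (Fin n) (Fin n) ℝ)
    (y : ℕ → ℝ) (i : Fin n) : (O.basisMatrix A *ᵥ fun l => y l) i =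
      ∑ l ∈ Finset.range n, O.vec n A i l * y l := by
  rw [Finset.sum_range]
  rfl

theorem Eigensolver.sum_sq_coord (O : Eigensolver) {A : Matrix (Fin n) (Fin n) ℝ}
    (hA : A.PosSemidef) (y : ℕ → ℝ) :
    ∑ j ∈ Finset.range n, (∑ l ∈ Finset.range n, O.vec n A j l * y l) ^ 2 =
      ∑ l ∈ Finset.range n, y l ^ 2 := by
  set V := O.basisMatrix A with hV
  have h : Vᵀ * V = 1 := mul_eq_one_comm.mp (O.basisMatrix_mul_transpose hA)
  have h2 : (V *ᵥ fun l => y l) ⬝ᵥ (V *ᵥ fun l => y l) = (fun l : Fin n => y l) ⬝ᵥ fun l => y l := by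
    rw [Matrix.dotProduct_mulVec, Matrix.vecMul_mulVec, ← Matrix.mulVec_transpose, h]
    simp
  rw [Finset.sum_range, Finset.sum_range]
  simp only [dotProduct, hV, Eigensolver.basisMatrix_mulVec] at h2
  simpa only [sq] using h2

theorem Eigensolver.quadForm_eq (O : Eigensolver) {A : Matrix (Fin n) (Fin n) ℝ}
    (hA : A.PosSemidef) (y : ℕ → ℝ) :
    (fun l : Fin n => y l) ⬝ᵥ (A *ᵥ fun l => y l) =
      lowRank n n (O.val n A) (O.vec n A) y := by
  set V := O.basisMatrix A with hV
  have h : Vᵀ * V = 1 := mul_eq_one_comm.mp (O.basisMatrix_mul_transpose hA)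
  have h1 : A * Vᵀ = Vᵀ * Matrix.diagonal fun i : Fin n => O.val n A i := by
    ext p i
    rw [Matrix.mul_diagonal, Matrix.mul_apply, mul_comm]
    exact O.eigen n A hA.isHermitian i p
  have h2 : A = Vᵀ * (Matrix.diagonal fun i : Fin n => O.val n A i) * V := by
    rw [← h1, Matrix.mul_assoc, h, Matrix.mul_one]
  have h3 : (fun l : Fin n => y l) ⬝ᵥ (A *ᵥ fun l => y l) = (V *ᵥ fun l => y l) ⬝ᵥ
      ((Matrix.diagonal fun i : Fin n => O.val n A i) *ᵥ (V *ᵥ fun l => y l)) := by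
    conv_lhs => rw [h2]
    rw [← Matrix.mulVec_mulVec, ← Matrix.mulVec_mulVec, Matrix.dotProduct_mulVec,
      Matrix.vecMul_transpose]
  rw [h3, lowRank, Finset.sum_range, dotProduct]
  refine Finset.sum_congr rfl fun i _ => ?_
  rw [Matrix.mulVec_diagonal, hV, Eigensolver.basisMatrix_mulVec]
  ring

theorem Eigensolver.quadForm_nonneg (O : Eigensolver) {A : Matrix (Fin n) (Fin n) ℝ}
    (hA : A.PosSemidef) (y : ℕ → ℝ) : 0 ≤ lowRank n n (O.val n A) (O.vec n A) y :=
  lowRank_nonneg (fun _ hj => O.val_nonneg hA hj) y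

theorem Eigensolver.lowRank_le_quadForm (O : Eigensolver) {A : Matrix (Fin n) (Fin n) ℝ}
    (hA : A.PosSemidef) (hd : d ≤ n) (y : ℕ → ℝ) :
    lowRank n d (O.val n A) (O.vec n A) y ≤ lowRank n n (O.val n A) (O.vec n A) y :=
  Finset.sum_le_sum_of_subset_of_nonneg (Finset.range_subset_range.mpr hd) fun _ hj _ =>
    mul_nonneg (O.val_nonneg hA (Finset.mem_range.mp hj)) (sq_nonneg _)

/-- For a unit vector `y`, the part of the quadratic form missed by the first `d` eigenvectors is
at most `λ_{d+1}` times the squared length of the projection to the other eigenvectors. -/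
theorem Eigensolver.val_mul_quadForm_le (O : Eigensolver) {A : Matrix (Fin n) (Fin n) ℝ}
    (hA : A.PosSemidef) (hd : d + 1 ≤ n) {y : ℕ → ℝ} (hy : ∑ l ∈ Finset.range n, y l ^ 2 = 1) :
    O.val n A 0 * lowRank n n (O.val n A) (O.vec n A) y ≤
      (O.val n A 0 - O.val n A d) * lowRank n d (O.val n A) (O.vec n A) y +
        O.val n A d * O.val n A 0 := by
  set b : ℕ → ℝ := fun j => (∑ l ∈ Finset.range n, O.vec n A j l * y l) ^ 2 with hb
  have hb0 : ∀ j, 0 ≤ b j := fun j => sq_nonneg _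
  have hsum : ∑ j ∈ Finset.range n, b j = 1 := (O.sum_sq_coord hA y).trans hy
  have hsplit : ∀ f : ℕ → ℝ, ∑ j ∈ Finset.range n, f j =
      ∑ j ∈ Finset.range d, f j + ∑ j ∈ Finset.Ico d n, f j := fun f =>
    (Finset.sum_range_add_sum_Ico f (by omega)).symm
  have h1 : lowRank n d (O.val n A) (O.vec n A) y ≤ O.val n A 0 * ∑ j ∈ Finset.range d, b j := by
    rw [lowRank, Finset.mul_sum]
    refine Finset.sum_le_sum fun j hj => mul_le_mul_of_nonneg_right ?_ (hb0 j)
    have := Finset.mem_range.mp hj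
    exact O.val_antitone hA (Nat.zero_le j) (by omega)
  have h2 : ∑ j ∈ Finset.Ico d n, O.val n A j * b j ≤
      O.val n A d * ∑ j ∈ Finset.Ico d n, b j := by
    rw [Finset.mul_sum]
    refine Finset.sum_le_sum fun j hj => mul_le_mul_of_nonneg_right ?_ (hb0 j)
    have := Finset.mem_Ico.mp hj
    exact O.val_antitone hA this.1 this.2
  have h3 : lowRank n n (O.val n A) (O.vec n A) y = lowRank n d (O.val n A) (O.vec n A) y +
      ∑ j ∈ Finset.Ico d n, O.val n A j * b j := hsplit _
  rw [hsplit] at hsum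
  have h0 : 0 ≤ O.val n A 0 := O.val_nonneg hA (by omega)
  have hd0 : 0 ≤ O.val n A d := O.val_nonneg hA (by omega)
  -- The tail is at most `λ_{d+1}` times `1 - ∑ b_j`, the sum running over the first `d` indices,
  -- and `h1` bounds that sum from below by the low-rank form divided by `λ_1`. Everything is kept
  -- multiplied by `λ_1` to avoid division.
  rw [eq_sub_of_add_eq' hsum] at h2
  rw [h3]
  nlinarith [mul_le_mul_of_nonneg_left h2 h0, mul_le_mul_of_nonneg_left h1 hd0]

/-! ### Correctness of the output -/

/-- Extension of a vector by zeros. -/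
def extend (y : Fin n → ℝ) (l : ℕ) : ℝ := if h : l < n then y ⟨l, h⟩ else 0

theorem extend_apply (y : Fin n → ℝ) : (fun l : Fin n => extend y l) = y := by
  funext l
  exact dif_pos l.2

theorem card_filter_fin (x : ℕ → ℝ) :
    (Finset.univ.filter fun i : Fin n => x i ≠ 0).card =
      ((Finset.range n).filter (x · ≠ 0)).card := by
  rw [← Finset.card_map Fin.valEmbedding]
  congr 1
  ext l
  simp only [Finset.mem_map, Finset.mem_filter, Finset.mem_univ, true_and, Finset.mem_range,
    Fin.valEmbedding_apply]
  constructor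
  · rintro ⟨i, hi, rfl⟩
    exact ⟨i.2, hi⟩
  · rintro ⟨hl, h⟩
    exact ⟨⟨l, hl⟩, h, rfl⟩

theorem isSparseUnit_iff (x : ℕ → ℝ) : IsSparseUnit k (fun l : Fin n => x l) ↔
    ∑ l ∈ Finset.range n, x l ^ 2 = 1 ∧ ((Finset.range n).filter (x · ≠ 0)).card = k := by
  rw [IsSparseUnit, card_filter_fin, Finset.sum_range]

/-- The algorithm's answer in the case `d = 0`. -/
theorem isApproxSparsePC_uniform {A : Matrix (Fin n) (Fin n) ℝ} (hA : A.PosSemidef)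
    (hk0 : 0 < k) (hk : k ≤ n) {ε : ℝ} (hε : 1 ≤ ε) {x : Fin n → ℝ}
    (hx : ∀ l : Fin n, x l = if (l : ℕ) < k then 1 / √k else 0) :
    IsApproxSparsePC A k ε x := by
  obtain ⟨O⟩ := Eigensolver.nonempty
  have hx' : x = fun l : Fin n => (fun l : ℕ => if l < k then 1 / √(k : ℝ) else 0) l :=
    funext hx
  have hk' : (0 : ℝ) < k := by exact_mod_cast hk0
  have hfilter : (Finset.range n).filter (· < k) = Finset.range k := by
    ext l
    simp only [Finset.mem_filter, Finset.mem_range]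
    omega
  refine ⟨?_, fun y _ => ?_⟩
  · rw [hx']
    refine (isSparseUnit_iff (n := n) fun l => if l < k then 1 / √(k : ℝ) else 0).mpr ⟨?_, ?_⟩
    · simp only [ite_pow, ne_eq, OfNat.ofNat_ne_zero, not_false_eq_true, zero_pow]
      rw [← Finset.sum_filter, hfilter, Finset.sum_const, Finset.card_range, nsmul_eq_mul, div_pow,
        Real.sq_sqrt hk'.le]
      field_simp
    · rw [Finset.filter_congr (q := (· < k)) fun l _ => ?_, hfilter, Finset.card_range]
      simp
      intro h1 h2
      omega
  · have h1 := O.quadForm_nonneg hA (extend x)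
    have h2 := O.quadForm_nonneg hA (extend y)
    rw [← O.quadForm_eq hA, extend_apply] at h1 h2
    nlinarith

/-- The algorithm's answer in the case `d > 0`. -/
theorem isApproxSparsePC_of_bestSoFar {A : Matrix (Fin n) (Fin n) ℝ} (hA : A.PosSemidef)
    (hk0 : 0 < k) (hk : k ≤ n) (hd : 0 < d) (hdn : d + 1 ≤ n) {ρ ε : ℝ} (hρ : 0 < ρ) (hρ1 : ρ ≤ 1)
    (h0 : 0 < O.val n A 0) (hval : O.val n A d = ρ * O.val n A 0) (hN : 2 * d ≤ N * ρ)
    (hε : ρ ≤ ε * (k / n)) {best : ℝ} {x : ℕ → ℝ}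
    (hbest : BestSoFar n k d N (O.val n A) (O.vec n A) ((2 * N + 1) ^ d) best x) :
    IsApproxSparsePC A k ε fun l : Fin n => x l := by
  set lam := O.val n A with hlamdef
  set v := O.vec n A with hvdef
  obtain ⟨hfound, -, hmax⟩ := hbest
  have hn : 0 < n := by omega
  have hk' : (0 : ℝ) < k := by exact_mod_cast hk0
  have hn' : (0 : ℝ) < n := by exact_mod_cast hn
  have hd' : (1 : ℝ) ≤ d := by exact_mod_cast hd
  have hN' : (0 : ℝ) < N := by
    by_contra h
    nlinarith [not_lt.mp h]
  have hN0 : 0 < N := by exact_mod_cast hN'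
  have hN1 : (1 : ℝ) ≤ N := by exact_mod_cast hN0
  have hδ0 : (0 : ℝ) < k / n := by positivity
  have hδ1 : (k : ℝ) / n ≤ 1 := div_le_one_of_le₀ (by exact_mod_cast hk) hn'.le
  have hε0 : 0 < ε := by
    by_contra h
    nlinarith [mul_nonneg (neg_nonneg.mpr (not_lt.mp h)) hδ0.le]
  have hερ : ρ ≤ ε := hε.trans (mul_le_of_le_one_right hε0.le hδ1)
  have hlam : ∀ j < d, 0 ≤ lam j := fun j hj => O.val_nonneg hA (by omega)
  -- the best score
  obtain ⟨t0, ht0, hs0⟩ := exists_mul_le_score (v := v) (lam := lam) hk0 hk hN0 hd h0.le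
    (O.sum_vec_sq hA hn)
  have hlead : k / n * lam 0 ≤ best := hs0.trans (hmax t0 ht0)
  have hbest0 : 0 < best := (by positivity : 0 < k / n * lam 0).trans_le hlead
  obtain ⟨t, htpos, rfl, hx⟩ := hfound.resolve_left hbest0.ne'
  have hr : lam d / lam 0 = ρ := by rw [hval]; field_simp
  rw [hr] at hx
  set w := gridComb d N lam v t with hw
  have hW : 0 < topSum n k w n := by
    refine (topSum_nonneg w).lt_of_ne fun h => ?_
    rw [score, ← hw, ← h, zero_div] at htpos
    exact lt_irrefl _ htpos
  have hxfun : (fun l : Fin n => x l) = fun l : Fin n => truncation n k ρ w l :=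
    funext fun l => hx l l.2
  rw [hxfun]
  have hF := score_le_lowRank_truncation (k := k) (v := v) (n := n) hlam hρ.le htpos
  rw [← hw] at hF
  set F := lowRank n d lam v (truncation n k ρ w) with hFdef
  set s := score n k d N lam v t with hs
  refine ⟨?_, fun y hy => ?_⟩
  · rw [isSparseUnit_iff]
    refine ⟨sum_truncation_sq hW, ?_⟩
    rw [Finset.filter_congr (q := (rank n w · < k)) fun l _ =>
      truncation_ne_zero_iff hn hρ hW l]
    exact card_topSet hk w
  · have hX := O.lowRank_le_quadForm hA (show d ≤ n by omega) (truncation n k ρ w)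
    rw [← O.quadForm_eq hA] at hX
    rw [← extend_apply y] at hy ⊢
    rw [O.quadForm_eq hA (extend y)]
    rw [isSparseUnit_iff] at hy
    obtain ⟨t', ht', hyt⟩ := exists_lowRank_le_score (v := v) hk0 hk hN0 hlam hy.1 hy.2.le
    have hY := O.val_mul_quadForm_le hA hdn hy.1
    have hY0 := O.quadForm_nonneg hA (extend y)
    have hb0 := lowRank_nonneg (n := n) (v := v) hlam (extend y)
    rw [← hlamdef, ← hvdef] at hY hX hY0 ⊢
    set Y := lowRank n n lam v (extend y)
    set b := lowRank n d lam v (extend y)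
    -- From `2d ≤ N ρ ≤ N² ρ`, since `N ≥ 1`.
    have hgrid : (d : ℝ) / N ^ 2 ≤ ρ / 2 := by
      rw [div_le_iff₀ (by positivity)]
      nlinarith [mul_le_mul_of_nonneg_left hN1 (mul_nonneg hρ.le hN'.le)]
    have hbs : (1 - ρ / 2) * b ≤ s := by
      refine le_trans ?_ (hyt.trans (hmax t' ht'))
      exact mul_le_mul_of_nonneg_right (by linarith) hb0
    -- The losses from the grid and from the fillers combine to `(1 - ρ / 2)² ≥ 1 - ρ`, the factor
    -- of `b` in `hYb`.
    have hFb : (1 - ρ) * b ≤ F := by nlinarith [mul_nonneg (sq_nonneg ρ) hb0]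
    have hFl : (1 - ρ / 2) * (k / n * lam 0) ≤ F :=
      (mul_le_mul_of_nonneg_left hlead (by linarith)).trans hF
    have hYb : Y ≤ (1 - ρ) * b + ρ * lam 0 := by
      rw [hval] at hY
      refine le_of_mul_le_mul_left (a := lam 0) ?_ h0
      linarith
    have hF0 : 0 ≤ F := lowRank_nonneg hlam _
    refine le_trans ?_ hX
    rcases le_total 1 ε with h1 | h1
    · exact (mul_nonpos_of_nonpos_of_nonneg (by linarith) hY0).trans hF0
    -- It remains to bound `(1 - ε) ρ λ_1` by `ε F`. As `ρ ≤ ε`, the factor `1 - ε` may be weakened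
    -- to `1 - ρ / 2`, which is the loss in the lower bound `hFl` for `F`.
    · have e1 : (1 - ε) * Y ≤ (1 - ε) * (F + ρ * lam 0) :=
        mul_le_mul_of_nonneg_left (by linarith) (by linarith)
      have e2 : ρ * lam 0 ≤ ε * (k / n) * lam 0 := mul_le_mul_of_nonneg_right hε h0.le
      have e3 : ε * ((1 - ρ / 2) * (k / n * lam 0)) ≤ ε * F :=
        mul_le_mul_of_nonneg_left hFl hε0.le
      have e4 : (1 - ρ / 2) * (ρ * lam 0) ≤ (1 - ρ / 2) * (ε * (k / n) * lam 0) :=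
        mul_le_mul_of_nonneg_left e2 (by linarith)
      have e5 : (1 - ε) * (ρ * lam 0) ≤ (1 - ρ / 2) * (ρ * lam 0) :=
        mul_le_mul_of_nonneg_right (by linarith) (by positivity)
      linarith

/-! ### Asymptotics -/

/-- The logarithm is not needed for the growth: it is at least `1` from `n = 3` on. -/
theorem isBigO_mul_pow (K p : ℕ) {e : ℝ} (he : p ≤ e) :
    (fun n : ℕ => ((K * n ^ p : ℕ) : ℝ)) =O[atTop] fun n : ℕ => (n : ℝ) ^ e * Real.log n := by
  refine IsBigO.of_bound K ?_
  filter_upwards [eventually_ge_atTop 3] with n hn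
  have hn1 : (3 : ℝ) ≤ n := by exact_mod_cast hn
  have hlog : 1 ≤ Real.log n := by
    rw [Real.le_log_iff_exp_le (by linarith)]
    linarith [Real.exp_one_lt_d9]
  have hpow : (n : ℝ) ^ p ≤ (n : ℝ) ^ e := by
    rw [← Real.rpow_natCast]
    exact Real.rpow_le_rpow_of_exponent_le (by linarith) he
  have hpos : 0 ≤ (n : ℝ) ^ e := by positivity
  rw [Real.norm_of_nonneg (by positivity), Real.norm_of_nonneg (by positivity), Nat.cast_mul,
    Nat.cast_pow]
  gcongr
  nlinarith

theorem isBigO_mul_pow_pow (K p : ℕ) :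
    (fun n : ℕ => ((K * n ^ p : ℕ) : ℝ)) =O[atTop] fun n : ℕ => (n : ℝ) ^ p := by
  simp only [Nat.cast_mul, Nat.cast_pow]
  exact isBigO_const_mul_self _ _ _

end SparsePCA

end

/-! ### The main theorem: choice of constants and the two cases for `d` -/

theorem corollary2 :
    ∃ P : SparsePCA.Cmd,
      ∀ (α δ ε : ℝ), 0 < α → 0 < δ → δ ≤ 1 → 0 < ε →
      ∀ d : ℕ, (d : ℝ) < (1 / (ε * δ)) ^ (1 / α) → (1 / (ε * δ)) ^ (1 / α) ≤ (d : ℝ) + 1 →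
      ∃ T : ℕ → ℕ,
        ((fun n : ℕ => (T n : ℝ)) =O[atTop]
          fun n : ℕ => (n : ℝ) ^ ((1 / (ε * δ)) ^ (1 / α) + 1) * Real.log n) ∧
        ((fun n : ℕ => (T n : ℝ)) =O[atTop]
          fun n : ℕ => (n : ℝ) ^ ((1 / (ε * δ)) ^ α + 1) * Real.log n) ∧
        (∃ p : ℕ, (fun n : ℕ => (T n : ℝ)) =O[atTop] fun n : ℕ => (n : ℝ) ^ p) ∧
        ∀ (O : SparsePCA.Eigensolver) (n k : ℕ) (A : Matrix (Fin n) (Fin n) ℝ)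
          (hA : A.PosSemidef) (C : ℝ), 0 < C → d + 1 ≤ n → (k : ℝ) = δ * n →
          (∀ i : Fin n, (i : ℕ) ≤ d →
            SparsePCA.eigval hA.isHermitian i = C * ((i : ℝ) + 1) ^ (-α)) →
          SparsePCA.Solves O P k d A ε (T n) := by
  open SparsePCA in
  refine ⟨program, fun α δ ε hα hδ hδ1 hε d hd1 hd2 => ?_⟩
  have hc : 0 < 1 / (ε * δ) := by positivity
  have hkn : ∀ n k : ℕ, d + 1 ≤ n → (k : ℝ) = δ * n → 0 < k ∧ k ≤ n := by
    intro n k hn hk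
    have hn' : (0 : ℝ) < n := by exact_mod_cast (by omega : 0 < n)
    constructor
    · have : (0 : ℝ) < k := by rw [hk]; positivity
      exact_mod_cast this
    · have : (k : ℝ) ≤ n := by rw [hk]; exact mul_le_of_le_one_left hn'.le hδ1
      exact_mod_cast this
  rcases Nat.eq_zero_or_pos d with rfl | hd
  -- For `d = 0` the bound on `d` gives `1 / (ε δ) ≤ 1`, hence `ε ≥ 1` because `δ ≤ 1`. The constant
  -- is `60 + 70`, using `n ≥ 1`.
  · refine ⟨fun n => 130 * n ^ 1, isBigO_mul_pow _ _ ?_, isBigO_mul_pow _ _ ?_,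
      ⟨1, isBigO_mul_pow_pow _ _⟩, fun O n k A hA C _ hn hk _ => ?_⟩
    · have := Real.rpow_nonneg hc.le (1 / α)
      push_cast
      linarith
    · have := Real.rpow_nonneg hc.le α
      push_cast
      linarith
    · have hεδ : 1 ≤ ε * δ := by
        by_contra h
        have h1 : 1 < 1 / (ε * δ) := by
          rw [lt_div_iff₀ (by positivity)]; linarith
        have h2 := Real.one_lt_rpow h1 (by positivity : 0 < 1 / α)
        norm_num at hd2
        norm_num at h2
        linarith
      have hε1 : 1 ≤ ε := hεδ.trans (mul_le_of_le_one_right hε.le hδ1)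
      obtain ⟨t, s, hr, ht, hs⟩ := ends_program_of_eq_zero (O := O) (k := k) A
      obtain ⟨hk0, hk1⟩ := hkn n k hn hk
      refine ⟨t, s, hr, ht.trans (by simp only [pow_one]; omega), ?_⟩
      exact isApproxSparsePC_uniform hA hk0 hk1 hε1 fun l => hs l l.2
  · have hd' : (1 : ℝ) ≤ d := by exact_mod_cast hd
    have hq1 : 1 < (1 / (ε * δ)) ^ (1 / α) := hd'.trans_lt hd1
    have hc1 : 1 < 1 / (ε * δ) := by
      by_contra h
      exact (Real.rpow_le_one hc.le (not_lt.mp h) (by positivity : 0 ≤ 1 / α)).not_gt hq1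
    have hq2 : 1 < (1 / (ε * δ)) ^ α := Real.one_lt_rpow hc1 hα
    set ρ : ℝ := ((d : ℝ) + 1) ^ (-α) with hρdef
    have hρ : 0 < ρ := by positivity
    have hρ1 : ρ ≤ 1 := Real.rpow_le_one_of_one_le_of_nonpos (by linarith) (by linarith)
    -- Raising `(1 / (ε δ))^(1 / α) ≤ d + 1` to the power `α` and inverting; this is the only role
    -- of the lower bound on `d + 1`.
    have hρε : ρ ≤ ε * δ := by
      have h1 : 1 / (ε * δ) ≤ ((d : ℝ) + 1) ^ α := by
        have h2 := Real.rpow_le_rpow (by positivity) hd2 hα.le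
        rwa [← Real.rpow_mul hc.le, one_div_mul_cancel hα.ne', Real.rpow_one] at h2
      rw [hρdef, Real.rpow_neg (by positivity)]
      exact inv_le_of_inv_le₀ (by positivity) (by rwa [← one_div])
    -- The value found by `gridLoop`: by the power law the test there amounts to `i ρ < 2d`, with
    -- the scale `C` cancelled. It does not depend on `n`, so neither does `K`, which is the time
    -- bound of the program evaluated at `n = 1`.
    set N := ⌈2 * d / ρ⌉₊ with hN
    set K := (d + 1) + N * 60 + ((2 * N + 1) ^ d + 1) * (150 + 400 +
      d * (100 + (2 * N + 1) ^ d * 50 + 300) + 810) + 200 with hK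
    refine ⟨fun n => K * n ^ 2, isBigO_mul_pow _ _ (by push_cast; linarith),
      isBigO_mul_pow _ _ (by push_cast; linarith), ⟨2, isBigO_mul_pow_pow _ _⟩,
      fun O n k A hA C hC hn hk heig => ?_⟩
    obtain ⟨hk0, hk1⟩ := hkn n k hn hk
    have hval0 : O.val n A 0 = C := by
      have h1 := O.val_eq n A hA.isHermitian ⟨0, by omega⟩
      rw [heig _ (Nat.zero_le _)] at h1
      simpa using h1
    have hvald : O.val n A d = ρ * O.val n A 0 := by
      have h1 := O.val_eq n A hA.isHermitian ⟨d, by omega⟩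
      rw [heig _ le_rfl] at h1
      rw [hval0, mul_comm]
      exact h1
    have hgrid : ∀ i : ℕ, (i : ℝ) * O.val n A d < 2 * d * O.val n A 0 ↔ i < N := by
      intro i
      rw [hN, Nat.lt_ceil, lt_div_iff₀ hρ, hvald, hval0, ← mul_assoc]
      exact mul_lt_mul_iff_left₀ hC
    obtain ⟨t, s, hr, ht, hs⟩ := ends_program_of_pos (k := k) A hd hn hgrid
    refine ⟨t, s, hr, ht.trans ?_, ?_⟩
    · have h1 : 1 ≤ n := by omega
      have h2 : n ≤ n ^ 2 := Nat.le_self_pow two_ne_zero n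
      have h3 : 1 ≤ n ^ 2 := h1.trans h2
      set D := (2 * N + 1) ^ d
      calc (d + 1) * n ^ 2 + N * 60 + (D + 1) * (n * (n * 150 + 400) +
              d * (n * 100 + D * 50 + 300) + 810) + 200
          = (d + 1) * n ^ 2 + N * 60 * 1 + (D + 1) * (150 * n ^ 2 + 400 * n +
              d * (100 * n + D * 50 * 1 + 300 * 1) + 810 * 1) + 200 * 1 := by ring
        _ ≤ (d + 1) * n ^ 2 + N * 60 * n ^ 2 + (D + 1) * (150 * n ^ 2 + 400 * n ^ 2 +
              d * (100 * n ^ 2 + D * 50 * n ^ 2 + 300 * n ^ 2) + 810 * n ^ 2) +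
                200 * n ^ 2 := by gcongr
        _ = K * n ^ 2 := by rw [hK]; ring
    · have hn' : (0 : ℝ) < n := by exact_mod_cast (by omega : 0 < n)
      refine isApproxSparsePC_of_bestSoFar hA hk0 hk1 hd hn hρ hρ1 (by rw [hval0]; exact hC)
        hvald ?_ ?_ hs
      · rw [← div_le_iff₀ hρ]
        exact Nat.le_ceil _
      · rw [hk, mul_div_cancel_right₀ _ hn'.ne']
        exact hρε
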